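/- **Setting.** Let $\mathbb{C}^2_\times=\mathbb{C}^2\setminus\{0\}$ be the set of nonzero spinors $\kappa=(\xi,\eta)$, on which $SL(2,\mathbb{C})$ acts by matrix multiplication. Let $f(\kappa)=\kappa\kappa^*$, a map to $2\times2$ Hermitian matrices, with directional derivative $D_\kappa f(\nu)=\frac{d}{ds}\big|_{s=0}f(\kappa+s\nu)$, and let $\mathcal Z(\alpha,\beta)=(i\bar\beta,-i\bar\alpha)$. Identify Hermitian matrices with $\mathbb{R}^{1,3}$ by $$g\begin{pmatrix}a&b+ci\\ b-ci&d\end{pmatrix}=(T,X,Y,Z)=(a+d,\,2b,\,2c,\,a-d),$$ and let $\langle\cdot,\cdot\rangle$ be the Minkowski form of signature $(+,-,-,-)$ and $L^+=\{p:\langle p,p\rangle=0,\ T>0\}$. Under $g$, the set $L^+$ corresponds to the cone $\mathcal{H}_0^+$ of Hermitian matrices with determinant $0$ and positive trace. A *pointed oriented null flag* $[[p,v]]$ over either of these cones is a point $p$ of the cone, the plane $V$ spanned by $p$ and a tangent vector $v$ to the cone at $p$ linearly independent of $p$, and the orientation of the line $V/\mathbb{R}p$ given by $v$. * $F(\kappa)=[[f(\kappa),D_\kappa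 f(\mathcal Z\kappa)]]$, and $G$ is the map on flags induced by $g$. * Let $\mathbb{H}=\{x\in\mathbb{R}^{1,3}:\langle x,x\rangle=1,\ T>0\}$ and $h(p)=\{x\in\mathbb{H}:\langle x,p\rangle=1\}$. The map $H$ takes the flag $(p,V,o)$ to the horosphere $h(p)$ with the tangent line field $x\mapsto V\cap T_xh(p)$, oriented through $V\cap T_xh(p)\cong V/\mathbb{R}p$. * Let $\mathbb{D}$ be the open unit ball of $\mathbb{R}^3$ and $\mathbb{U}=\{(x,y,z)\in\mathbb{R}^3: z>0\}$, with the isometries $i:\mathbb{H}\to\mathbb{D}$, $i(T,X,Y,Z)=\frac{1}{1+T}(X,Y,Z)$, and $$j:\mathbb{D}\to\mathbb{U},\qquad j(X,Y,Z)=\frac{(2X,\,2Y,\,1-X^2-Y^2-Z^2)}{X^2+Y^2+(1-Z)^2}$$ (so $j$ extends to the boundary as stereographic projection $(x,y,z)\mapsto (x+iy)/(1-z)$). $I$ and $J$ are the maps induced by $i$, $j$ and their derivatives on horospheres with oriented tangent line fields. $A\in SL(2,\mathbb{C})$ acts on Hermitian matrices by $S\mapsto ASA^*$, on $\mathbb{R}^{1,3}$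 and $\mathbb{H}$ through $g$, and on $\mathbb{D}$ and $\mathbb{U}$ through $i$ and $j$. A *horosphere* in $\mathbb{U}$ is a plane $z=c$ with $c>0$, or a Euclidean sphere tangent to the plane $z=0$ with the point of tangency removed. A *decorated horosphere* in $\mathbb{U}$ is a horosphere with an oriented tangent line field that is parallel, i.e. invariant under the action of every $A\in SL(2,\mathbb{C})$ of trace $\pm2$ that preserves the horosphere. The set of them is $\mathfrak{H}_D(\mathbb{U})$, and $SL(2,\mathbb{C})$ acts on it by its action on $\mathbb{U}$ and the derivative of that action. The manifold structure on $\mathfrak{H}_D(\mathbb{U})$ comes from a bijection with $UTS^2\times\mathbb{R}$, where $UTS^2=\{(u,v)\in\mathbb{R}^3\times\mathbb{R}^3:|u|=|v|=1,\ u\cdot v=0\}$. To $((u,v),t)$ corresponds the decorated horosphere which, carried to $\mathbb{D}$ by $j^{-1}$, is the Euclidean sphere with diameter from $q=\tanh(t/2)\,u$ to $u$, without $u$, with the parallel oriented line field directed by $v$ at $q$. The quotient $\mathbb{C}^2_\times/\{\pm1\}$ carries the charts of $\mathbb{C}^2_\times$ transported along local inverses of the quotient map. **Theorem.** The above correspondence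 is a bijection $UTS^2\times\mathbb{R}\to\mathfrak{H}_D(\mathbb{U})$, and $SL(2,\mathbb{C})$ acts on $\mathfrak{H}_D(\mathbb{U})$ as described. The composition $K=J\circ I\circ H\circ G\circ F$ takes values in $\mathfrak{H}_D(\mathbb{U})$, and $K:\mathbb{C}^2_\times\to\mathfrak{H}_D(\mathbb{U})$ is smooth, surjective, exactly $2$-to-$1$, and $SL(2,\mathbb{C})$-equivariant. It induces a map $\mathbb{C}^2_\times/\{\pm1\}\to\mathfrak{H}_D(\mathbb{U})$, which is smooth, bijective and $SL(2,\mathbb{C})$-equivariant. The actions of $SL(2,\mathbb{C})$ on $\mathbb{C}^2_\times/\{\pm1\}$ and on $\mathfrak{H}_D(\mathbb{U})$ both factor through $PSL(2,\mathbb{C})$. -/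

import Mathlib

open scoped Matrix Manifold ContDiff Topology

noncomputable section

namespace SpinorHoro

/-! ## Spinors -/

/-- The group `SL(2, ℂ)`. -/
abbrev SL2C := Matrix.SpecialLinearGroup (Fin 2) ℂ

/-- The group `PSL(2, ℂ)`: the quotient of `SL(2, ℂ)` by its centre. -/
abbrev PSL2C := Matrix.ProjectiveSpecialLinearGroup (Fin 2) ℂ

/-- Nonzero spinors, `ℂ² ∖ {0}`, as an open submanifold of `ℂ²`. -/
def nonzeroSpinors : TopologicalSpace.Opens (Fin 2 → ℂ) :=
  ⟨{0}ᶜ, isOpen_compl_singleton⟩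

/-- The manifold of nonzero spinors. -/
abbrev Spinor := ↥nonzeroSpinors

theorem Spinor.ne_zero (κ : Spinor) : (κ : Fin 2 → ℂ) ≠ 0 := κ.2

instance : LocallyCompactSpace Spinor :=
  nonzeroSpinors.isOpen.locallyCompactSpace

/-- `SL(2, ℂ)` acts on nonzero spinors by matrix multiplication. -/
instance : MulAction SL2C Spinor where
  smul A κ := ⟨A • (κ : Fin 2 → ℂ), fun h => Spinor.ne_zero κ (by
    have h' : A • (κ : Fin 2 → ℂ) = 0 := h
    simpa using congrArg (fun v => A⁻¹ • v) h')⟩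
  one_smul κ := Subtype.ext (one_smul SL2C (κ : Fin 2 → ℂ))
  mul_smul A B κ := Subtype.ext (mul_smul A B (κ : Fin 2 → ℂ))

/-- The group `{1, -1}` acts on nonzero spinors by multiplication. -/
instance : SMul ℤˣ Spinor where
  smul e κ := ⟨e • (κ : Fin 2 → ℂ), fun h => Spinor.ne_zero κ (by
    have h' : e • (κ : Fin 2 → ℂ) = 0 := h
    have h2 := congrArg (fun v => e⁻¹ • v) h'
    simp only [inv_smul_smul] at h2
    rw [h2, Units.smul_def, smul_zero])⟩

instance : MulAction ℤˣ Spinor where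
  one_smul κ := Subtype.ext (one_smul ℤˣ (κ : Fin 2 → ℂ))
  mul_smul e e' κ := Subtype.ext (mul_smul e e' (κ : Fin 2 → ℂ))

theorem Spinor.coe_smul (A : SL2C) (κ : Spinor) :
    ((A • κ : Spinor) : Fin 2 → ℂ) = (A : Matrix (Fin 2) (Fin 2) ℂ) *ᵥ (κ : Fin 2 → ℂ) := rfl

theorem Spinor.coe_units_smul (e : ℤˣ) (κ : Spinor) :
    ((e • κ : Spinor) : Fin 2 → ℂ) = e • (κ : Fin 2 → ℂ) := rfl

theorem Spinor.coe_neg_one_smul (κ : Spinor) :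
    (((-1 : ℤˣ) • κ : Spinor) : Fin 2 → ℂ) = -(κ : Fin 2 → ℂ) := by
  rw [Spinor.coe_units_smul, Units.smul_def]; simp

instance : ContinuousConstSMul ℤˣ Spinor where
  continuous_const_smul e := by
    refine Continuous.subtype_mk ?_ _
    have : Continuous fun v : Fin 2 → ℂ => e • v := by
      rcases Int.units_eq_one_or e with rfl | rfl
      · simpa using continuous_id'
      · simpa [Units.smul_def] using continuous_neg
    exact this.comp continuous_subtype_val

theorem Spinor.neg_one_smul_ne (κ : Spinor) : (-1 : ℤˣ) • κ ≠ κ := by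
  intro h
  have h' := congrArg (fun x : Spinor => (x : Fin 2 → ℂ)) h
  simp only [Spinor.coe_neg_one_smul] at h'
  exact Spinor.ne_zero κ (neg_eq_self.mp h')

instance : IsCancelSMul ℤˣ Spinor where
  right_cancel' e e' κ h := by
    rcases Int.units_eq_one_or e with rfl | rfl <;> rcases Int.units_eq_one_or e' with rfl | rfl
    · rfl
    · exact absurd (h.symm.trans (one_smul _ _)) (Spinor.neg_one_smul_ne κ)
    · exact absurd (h.trans (one_smul _ _)) (Spinor.neg_one_smul_ne κ)
    · rfl

instance : SMulCommClass SL2C ℤˣ Spinor where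
  smul_comm A e κ := Subtype.ext (by
    rcases Int.units_eq_one_or e with rfl | rfl
    · simp
    · rw [Spinor.coe_smul, Spinor.coe_neg_one_smul, Spinor.coe_neg_one_smul, Spinor.coe_smul,
        Matrix.mulVec_neg])

/-- The quotient `(ℂ² ∖ {0}) / {±1}`. It carries the charts of `Spinor`, transported along local
inverses of the quotient map (`MulAction.instChartedSpaceQuotient`). -/
abbrev SpinorModSign := MulAction.orbitRel.Quotient ℤˣ Spinor

/-- The quotient map `ℂ² ∖ {0} → (ℂ² ∖ {0}) / {±1}`. -/
def modSign (κ : Spinor) : SpinorModSign := Quotient.mk _ κ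

/-- The action of `SL(2, ℂ)` on `(ℂ² ∖ {0}) / {±1}`, given by `A • [κ] = [A • κ]`. -/
instance : MulAction SL2C SpinorModSign where
  smul A := Quotient.map (fun κ : Spinor => A • κ) (by
    rintro _ κ ⟨e, rfl⟩
    exact ⟨e, (smul_comm A e κ).symm⟩)
  one_smul x := by
    induction x using Quotient.inductionOn with
    | h κ => exact congrArg modSign (one_smul SL2C κ)
  mul_smul A B x := by
    induction x using Quotient.inductionOn with
    | h κ => exact congrArg modSign (mul_smul A B κ)

theorem smul_mod (A : SL2C) (κ : Spinor) : A • modSign κ = modSign (A • κ) := rfl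

/-! ## Tangent vectors and pointed oriented null flags -/

/-- The tangent vectors to a subset `S` of a vector space at a point `q`: the velocities of curves
through `q` that run in `S`. -/
def tangentVectors {E : Type*} [AddCommGroup E] [Module ℝ E] [TopologicalSpace E]
    [ContinuousSMul ℝ E] (S : Set E) (q : E) : Set E :=
  {w | ∃ γ : ℝ → E, γ 0 = q ∧ (∀ᶠ s in 𝓝 (0 : ℝ), γ s ∈ S) ∧ HasDerivAt γ w 0}

/-- The open half-plane `ℝ p + ℝ⁺ v`. -/
def halfPlane {E : Type*} [AddCommGroup E] [Module ℝ E] (p v : E) : Set E :=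
  {w | ∃ a b : ℝ, 0 < b ∧ w = a • p + b • v}

/-- A pointed oriented null flag `[[p, v]]` over a cone `C` (without its apex): a point `p` of `C`,
a plane `V` spanned by `p` and a tangent vector `v` to `C` at `p`, and an orientation of the line
`V / ℝ p`. The orientation is recorded as the set of vectors of `V` that represent positive elements
of `V / ℝ p`, which is the half-plane `ℝ p + ℝ⁺ v`. -/
structure NullFlag {E : Type*} [AddCommGroup E] [Module ℝ E] [TopologicalSpace E]
    [ContinuousSMul ℝ E] (C : Set E) where
  point : E
  point_mem : point ∈ C
  plane : Submodule ℝ E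
  pos : Set E
  spanned : ∃ v ∈ tangentVectors C point, LinearIndependent ℝ ![point, v] ∧
    plane = Submodule.span ℝ {point, v} ∧ pos = halfPlane point v

/-- The flag `[[p, v]]`. -/
def NullFlag.of {E : Type*} [AddCommGroup E] [Module ℝ E] [TopologicalSpace E]
    [ContinuousSMul ℝ E] {C : Set E} (p v : E) (hp : p ∈ C) (hv : v ∈ tangentVectors C p) (hpv : LinearIndependent ℝ ![p, v]) :
    NullFlag C where
  point := p
  point_mem := hp
  plane := Submodule.span ℝ {p, v}
  pos := halfPlane p v
  spanned := ⟨v, hv, hpv, rfl, rfl⟩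

/-! ## From spinors to flags in Hermitian matrices -/

/-- `2 × 2` Hermitian matrices, a real vector space of dimension four. -/
abbrev Herm := selfAdjoint (Matrix (Fin 2) (Fin 2) ℂ)

instance : ContinuousSMul ℝ Herm where
  continuous_smul := by
    refine Continuous.subtype_mk ?_ _
    exact continuous_fst.smul (continuous_subtype_val.comp continuous_snd)

/-- The Hermitian matrix `M` with `M = ((a, b + c i), (b - c i, d))`. -/
def herm (a b c d : ℝ) : Herm :=
  ⟨!![(a : ℂ), b + c * Complex.I; b - c * Complex.I, d], by
    rw [selfAdjoint.mem_iff, Matrix.star_eq_conjTranspose]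
    ext i j
    fin_cases i <;> fin_cases j <;> simp [Matrix.conjTranspose_apply, sub_eq_add_neg]⟩

/-- The cone of nonzero Hermitian matrices with determinant zero and positive trace. -/
def hermCone : Set Herm :=
  {S | (S : Matrix (Fin 2) (Fin 2) ℂ).det = 0 ∧ 0 < (S : Matrix (Fin 2) (Fin 2) ℂ).trace.re}

/-- The map `f(κ) = κ κ*` from spinors to Hermitian matrices. -/
def spinorSq (κ : Fin 2 → ℂ) : Herm :=
  ⟨Matrix.vecMulVec κ (star κ), by
    rw [selfAdjoint.mem_iff, Matrix.star_eq_conjTranspose, Matrix.conjTranspose_vecMulVec,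
      star_star]⟩

/-- The derivative `D_κ f (ν)` of `f` at `κ` in the direction `ν`. -/
def spinorSqDeriv (κ ν : Fin 2 → ℂ) : Herm := deriv (fun s : ℝ => spinorSq (κ + s • ν)) 0

/-- The map `(α, β) ↦ (i conj β, -i conj α)` on spinors. -/
def spinorZ (κ : Fin 2 → ℂ) : Fin 2 → ℂ :=
  ![star (κ 1) * Complex.I, -(star (κ 0) * Complex.I)]

theorem spinorSq_apply (κ : Fin 2 → ℂ) (i j : Fin 2) :
    (spinorSq κ : Matrix (Fin 2) (Fin 2) ℂ) i j = κ i * star (κ j) := rfl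

/-- `D_κ f (ν) = κ ν* + ν κ*`. -/
theorem hasDerivAt_spinorSq (κ ν : Fin 2 → ℂ) :
    HasDerivAt (fun s : ℝ => spinorSq (κ + s • ν))
      (spinorSq (κ + ν) - spinorSq κ - spinorSq ν) 0 := by
  refine HasFDerivAt.of_isLittleOTVS ?_
  have h0 : Filter.Tendsto (fun s : ℝ => s • spinorSq ν) (𝓝 0) (𝓝 0) := by
    have h : Continuous fun s : ℝ => s • spinorSq ν := by fun_prop
    simpa using h.tendsto 0
  have h1 := ((Asymptotics.isLittleOTVS_one (𝕜 := ℝ)).2 h0).smul_left (fun s : ℝ => s)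
  refine h1.congr (fun s => ?_) (fun s => ?_)
  · ext i j
    simp [spinorSq_apply]
    ring
  · simp

theorem spinorSqDeriv_eq (κ ν : Fin 2 → ℂ) :
    spinorSqDeriv κ ν = spinorSq (κ + ν) - spinorSq κ - spinorSq ν := by
  have h := (hasDerivAt_spinorSq κ ν).hasFDerivAt
  rw [spinorSqDeriv, deriv, h.differentiableAt.hasFDerivAt.unique h]
  simp

theorem spinorSqDeriv_apply (κ ν : Fin 2 → ℂ) (i j : Fin 2) :
    (spinorSqDeriv κ ν : Matrix (Fin 2) (Fin 2) ℂ) i j = κ i * star (ν j) + ν i * star (κ j) := by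
  rw [spinorSqDeriv_eq]
  simp [spinorSq_apply]
  ring

theorem spinorSq_mem_hermCone {κ : Fin 2 → ℂ} (hκ : κ ≠ 0) : spinorSq κ ∈ hermCone := by
  refine ⟨?_, ?_⟩
  · rw [Matrix.det_fin_two]
    simp only [spinorSq_apply]
    ring
  · rw [Matrix.trace_fin_two]
    simp only [spinorSq_apply, Complex.star_def, Complex.mul_conj, Complex.add_re,
      Complex.ofReal_re]
    rcases eq_or_ne (κ 0) 0 with h0 | h0
    · have h1 : κ 1 ≠ 0 := fun h1 => hκ (by ext i; fin_cases i <;> simp [h0, h1])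
      have := Complex.normSq_pos.2 h1
      have := Complex.normSq_nonneg (κ 0)
      linarith
    · have := Complex.normSq_pos.2 h0
      have := Complex.normSq_nonneg (κ 1)
      linarith

theorem spinorSqDeriv_mem_tangentVectors {κ : Fin 2 → ℂ} (hκ : κ ≠ 0) (ν : Fin 2 → ℂ) :
    spinorSqDeriv κ ν ∈ tangentVectors hermCone (spinorSq κ) := by
  refine ⟨fun s => spinorSq (κ + s • ν), by simp, ?_, ?_⟩
  · have hc : Continuous fun s : ℝ => κ + s • ν := by fun_prop
    have h0 : ∀ᶠ s in 𝓝 (0 : ℝ), κ + s • ν ≠ 0 :=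
      hc.continuousAt.eventually_ne (by simpa using hκ)
    exact h0.mono fun s hs => spinorSq_mem_hermCone hs
  · rw [spinorSqDeriv_eq]
    exact hasDerivAt_spinorSq κ ν

theorem linearIndependent_flag {κ : Fin 2 → ℂ} (hκ : κ ≠ 0) :
    LinearIndependent ℝ ![spinorSq κ, spinorSqDeriv κ (spinorZ κ)] := by
  rw [LinearIndependent.pair_iff]
  intro s t h
  have hij : ∀ i j, (s : ℂ) * (κ i * star (κ j)) +
      t * (κ i * star (spinorZ κ j) + spinorZ κ i * star (κ j)) = 0 := fun i j => by
    have := congrArg (fun M : Herm => (M : Matrix (Fin 2) (Fin 2) ℂ) i j) h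
    simpa [spinorSq_apply, spinorSqDeriv_apply, mul_add] using this
  have h00 := hij 0 0
  have h01 := hij 0 1
  have h11 := hij 1 1
  have hpos : 0 < Complex.normSq (κ 0) + Complex.normSq (κ 1) := by
    have := (spinorSq_mem_hermCone hκ).2
    rw [Matrix.trace_fin_two] at this
    simpa only [spinorSq_apply, Complex.star_def, Complex.mul_conj, Complex.add_re,
      Complex.ofReal_re] using this
  rw [Complex.ext_iff] at h00 h01 h11
  simp [spinorZ, Complex.normSq] at h00 h01 h11 hpos
  generalize (κ 0).re = a at *
  generalize (κ 0).im = b at *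
  generalize (κ 1).re = c at *
  generalize (κ 1).im = d at *
  have hs : s = 0 := by
    have : s * (a * a + b * b + (c * c + d * d)) = 0 := by linear_combination h00.1 + h11.1
    exact (mul_eq_zero.1 this).resolve_right hpos.ne'
  subst hs
  refine ⟨rfl, ?_⟩
  have : t * (a * a + b * b + (c * c + d * d)) ^ 2 = 0 := by
    linear_combination (2 * (a * d + b * c)) * h00.1 + (2 * (c * d - a * b)) * h01.1 +
      (a * a - b * b - d * d + c * c) * h01.2
  exact (mul_eq_zero.1 this).resolve_right (pow_ne_zero 2 hpos.ne')

/-- The map `F` from nonzero spinors to flags: `F(κ) = [[f(κ), D_κ f (Z κ)]]`, where `Z` is the map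
`spinorZ`. -/
def mapF (κ : Spinor) : NullFlag hermCone :=
  NullFlag.of (spinorSq κ) (spinorSqDeriv κ (spinorZ κ))
    (spinorSq_mem_hermCone (Spinor.ne_zero κ))
    (spinorSqDeriv_mem_tangentVectors (Spinor.ne_zero κ) _)
    (linearIndependent_flag (Spinor.ne_zero κ))

/-! ## Minkowski space -/

/-- Minkowski space, with coordinates `(T, X, Y, Z) = (p 0, p 1, p 2, p 3)`. -/
abbrev Mink := Fin 4 → ℝ

/-- The Minkowski inner product, of signature `(+, -, -, -)`. -/
def minkInner (p q : Mink) : ℝ := p 0 * q 0 - p 1 * q 1 - p 2 * q 2 - p 3 * q 3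

/-- The positive light cone. -/
def lightCone : Set Mink := {p | minkInner p p = 0 ∧ 0 < p 0}

theorem Herm.conj_apply (M : Herm) (i j : Fin 2) : (starRingEnd ℂ) (M.1 i j) = M.1 j i := by
  have h := congrArg (fun N : Matrix (Fin 2) (Fin 2) ℂ => N j i) (selfAdjoint.mem_iff.1 M.2)
  rw [Matrix.star_eq_conjTranspose] at h
  exact h

/-- The isomorphism `g` from Hermitian matrices to Minkowski space, taking
`((a, b + c i), (b - c i, d))` to `(a + d, 2 b, 2 c, a - d)`. -/
def hermEquiv : Herm ≃ₗ[ℝ] Mink where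
  toFun M := ![(M.1 0 0).re + (M.1 1 1).re, 2 * (M.1 0 1).re, 2 * (M.1 0 1).im,
    (M.1 0 0).re - (M.1 1 1).re]
  invFun p := herm ((p 0 + p 3) / 2) (p 1 / 2) (p 2 / 2) ((p 0 - p 3) / 2)
  map_add' M N := by
    ext i
    fin_cases i <;> simp <;> ring
  map_smul' r M := by
    ext i
    fin_cases i <;> simp <;> ring
  left_inv M := by
    have h00 := Herm.conj_apply M 0 0
    have h01 := Herm.conj_apply M 0 1
    have h11 := Herm.conj_apply M 1 1
    ext i j
    fin_cases i <;> fin_cases j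
    · simp [Complex.ext_iff, herm] at h00 ⊢
      linarith
    · simp [herm]
    · simp [Complex.ext_iff, herm] at h01 ⊢
      exact h01
    · simp [Complex.ext_iff, herm] at h11 ⊢
      linarith
  right_inv p := by
    ext i
    fin_cases i <;> simp [herm] <;> ring

theorem continuous_hermEquiv : Continuous hermEquiv := by
  refine continuous_pi fun i => ?_
  have h : ∀ i j, Continuous fun M : Herm => M.1 i j := fun i j =>
    (continuous_subtype_val.matrix_elem i j)
  fin_cases i
  · exact (Complex.continuous_re.comp (h 0 0)).add (Complex.continuous_re.comp (h 1 1))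
  · exact continuous_const.mul (Complex.continuous_re.comp (h 0 1))
  · exact continuous_const.mul (Complex.continuous_im.comp (h 0 1))
  · exact (Complex.continuous_re.comp (h 0 0)).sub (Complex.continuous_re.comp (h 1 1))

theorem hermEquiv_mem_lightCone {M : Herm} (hM : M ∈ hermCone) : hermEquiv M ∈ lightCone := by
  obtain ⟨hdet, htr⟩ := hM
  have h00 := Herm.conj_apply M 0 0
  have h01 := Herm.conj_apply M 0 1
  have h11 := Herm.conj_apply M 1 1
  rw [Matrix.det_fin_two, ← h01] at hdet
  rw [Matrix.trace_fin_two] at htr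
  rw [Complex.ext_iff] at h00 h11 hdet
  refine ⟨?_, by simpa [hermEquiv] using htr⟩
  simp at h00 h11 hdet htr
  have h00' : (M.1 0 0).im = 0 := by linarith
  have h11' : (M.1 1 1).im = 0 := by linarith
  simp only [h00', h11'] at hdet
  simp [minkInner, hermEquiv]
  linear_combination 4 * hdet.1

theorem hermEquiv_mem_tangentVectors {M W : Herm} (hW : W ∈ tangentVectors hermCone M) :
    hermEquiv W ∈ tangentVectors lightCone (hermEquiv M) := by
  obtain ⟨γ, h0, hγ, hd⟩ := hW
  refine ⟨fun s => hermEquiv (γ s), by simp [h0], hγ.mono fun s hs => hermEquiv_mem_lightCone hs, ?_⟩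
  let G : Herm →L[ℝ] Mink := ⟨hermEquiv.toLinearMap, continuous_hermEquiv⟩
  refine HasFDerivAt.of_isLittleOTVS ?_
  have h := (G.isBigOTVS_comp (l := 𝓝 (0 : ℝ))).trans_isLittleOTVS hd.hasFDerivAt.isLittleOTVS
  refine h.congr (fun s => ?_) (fun s => rfl)
  simp [G]

/-- The map `G` from flags in Hermitian matrices to flags in Minkowski space, induced by the linear
isomorphism `g`. -/
def mapG (P : NullFlag hermCone) : NullFlag lightCone where
  point := hermEquiv P.point
  point_mem := hermEquiv_mem_lightCone P.point_mem
  plane := P.plane.map hermEquiv.toLinearMap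
  pos := hermEquiv '' P.pos
  spanned := by
    obtain ⟨v, hv, hli, hpl, hpos⟩ := P.spanned
    refine ⟨hermEquiv v, hermEquiv_mem_tangentVectors hv, ?_, ?_, ?_⟩
    · have := hli.map' hermEquiv.toLinearMap hermEquiv.ker
      have he : ⇑hermEquiv.toLinearMap ∘ ![P.point, v] = ![hermEquiv P.point, hermEquiv v] := by
        ext i
        fin_cases i <;> rfl
      exact he ▸ this
    · rw [hpl, Submodule.map_span, Set.image_pair]; rfl
    · rw [hpos]
      ext w
      constructor
      · rintro ⟨_, ⟨a, b, hb, rfl⟩, rfl⟩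
        exact ⟨a, b, hb, by simp⟩
      · rintro ⟨a, b, hb, rfl⟩
        exact ⟨_, ⟨a, b, hb, rfl⟩, by simp⟩

/-! ## Horospheres with a line field -/

/-- A subset of a vector space (in practice a horosphere in a model of hyperbolic space), with a
set of directing vectors at each point. -/
@[ext]
structure OverlyDecorated (E : Type*) where
  carrier : Set E
  dir : E → Set E

/-- `dir` is an oriented tangent line field on `carrier`: at every point of `carrier` it is the open
half-line generated by some nonzero tangent vector, that is, the positive half of an oriented tangent
line. -/
def OverlyDecorated.IsOrientedLineField {E : Type*} [AddCommGroup E] [Module ℝ E]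
    [TopologicalSpace E] [ContinuousSMul ℝ E] (S : OverlyDecorated E) : Prop :=
  (∀ q ∈ S.carrier, ∃ w ∈ tangentVectors S.carrier q, w ≠ 0 ∧
    S.dir q = {x | ∃ c : ℝ, 0 < c ∧ x = c • w}) ∧
  ∀ q ∉ S.carrier, S.dir q = ∅

/-- The image under a map `φ` and its derivative. -/
def OverlyDecorated.map {E E' : Type*} [NormedAddCommGroup E] [NormedSpace ℝ E]
    [NormedAddCommGroup E'] [NormedSpace ℝ E'] (φ : E → E') (S : OverlyDecorated E) :
    OverlyDecorated E' where
  carrier := φ '' S.carrier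
  dir y := {x | ∃ q ∈ S.carrier, φ q = y ∧ ∃ w ∈ S.dir q, x = fderiv ℝ φ q w}

/-- The hyperboloid model of hyperbolic space. -/
def hyperboloid : Set Mink := {x | minkInner x x = 1 ∧ 0 < x 0}

/-- The map `H`: a flag `(p, V, o)` goes to the horosphere `h(p) = {x | ⟨x, p⟩ = 1}` of the
hyperboloid, with the oriented line field given at `x` by the line `V ∩ T_x h(p)`, oriented by the
isomorphism of this line with `V / ℝ p`. -/
def mapH (P : NullFlag lightCone) : OverlyDecorated Mink where
  carrier := {x | x ∈ hyperboloid ∧ minkInner x P.point = 1}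
  dir x := {w | x ∈ hyperboloid ∧ minkInner x P.point = 1 ∧ w ∈ P.pos ∧
    w ∈ tangentVectors {x | x ∈ hyperboloid ∧ minkInner x P.point = 1} x}

/-- Three-dimensional space, containing the disc model `disc` and the upper half space model
`upperHalf` of hyperbolic space. -/
abbrev R3 := Fin 3 → ℝ

/-- The disc model: the open unit ball. -/
def disc : Set R3 := {y | y ⬝ᵥ y < 1}

/-- The upper half space model. -/
def upperHalf : Set R3 := {y | 0 < y 2}

/-- The isometry from the hyperboloid to the disc model, projection from `(-1, 0, 0, 0)`. -/
def iMap (x : Mink) : R3 := ![x 1 / (1 + x 0), x 2 / (1 + x 0), x 3 / (1 + x 0)]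

/-- The inverse of `iMap`. -/
def iInv (y : R3) : Mink :=
  ![(1 + y ⬝ᵥ y) / (1 - y ⬝ᵥ y), 2 * y 0 / (1 - y ⬝ᵥ y), 2 * y 1 / (1 - y ⬝ᵥ y),
    2 * y 2 / (1 - y ⬝ᵥ y)]

/-- The isometry from the disc model to the upper half space model which on the boundary is the
stereographic projection `(x, y, z) ↦ (x + i y) / (1 - z)`. -/
def jMap (y : R3) : R3 :=
  ![2 * y 0 / (y 0 ^ 2 + y 1 ^ 2 + (1 - y 2) ^ 2), 2 * y 1 / (y 0 ^ 2 + y 1 ^ 2 + (1 - y 2) ^ 2),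
    (1 - y ⬝ᵥ y) / (y 0 ^ 2 + y 1 ^ 2 + (1 - y 2) ^ 2)]

/-- The inverse of `jMap`. -/
def jInv (y : R3) : R3 :=
  ![2 * y 0 / (y 0 ^ 2 + y 1 ^ 2 + (y 2 + 1) ^ 2), 2 * y 1 / (y 0 ^ 2 + y 1 ^ 2 + (y 2 + 1) ^ 2),
    (y ⬝ᵥ y - 1) / (y 0 ^ 2 + y 1 ^ 2 + (y 2 + 1) ^ 2)]

/-- The map `I`, induced by the isometry from the hyperboloid to the disc model. -/
def mapI (S : OverlyDecorated Mink) : OverlyDecorated R3 := S.map iMap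

/-- The map `J`, induced by the isometry from the disc model to the upper half space model. -/
def mapJ (S : OverlyDecorated R3) : OverlyDecorated R3 := S.map jMap

/-! ## The action of `SL(2, ℂ)` on the models -/

/-- The action of `A` on Hermitian matrices, `S ↦ A S A*`. -/
def actHerm (A : SL2C) (S : Herm) : Herm :=
  ⟨(A : Matrix (Fin 2) (Fin 2) ℂ) * S.1 * star (A : Matrix (Fin 2) (Fin 2) ℂ), by
    rw [selfAdjoint.mem_iff, star_mul, star_mul, star_star, selfAdjoint.mem_iff.1 S.2, mul_assoc]⟩

/-- The action of `A` on Minkowski space, transported by `g`. -/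
def actMink (A : SL2C) (p : Mink) : Mink := hermEquiv (actHerm A (hermEquiv.symm p))

/-- The action of `A` on the disc model, transported from the hyperboloid. -/
def actDisc (A : SL2C) (y : R3) : R3 := iMap (actMink A (iInv y))

/-- The action of `A` on the upper half space model, transported from the disc model. -/
def actUpper (A : SL2C) (y : R3) : R3 := jMap (actDisc A (jInv y))

/-! ## Decorated horospheres in the upper half space model -/

/-- The horospheres of the upper half space model: horizontal planes, and Euclidean spheres tangent
to the boundary plane with the point of tangency removed. -/
def IsHorosphere (s : Set R3) : Prop :=
  (∃ c : ℝ, 0 < c ∧ s = {y | y 2 = c}) ∨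
  ∃ a b r : ℝ, 0 < r ∧
    s = {y | y ∈ upperHalf ∧ (y 0 - a) ^ 2 + (y 1 - b) ^ 2 + (y 2 - r) ^ 2 = r ^ 2}

/-- The oriented line field is parallel: it is invariant under every parabolic isometry (a matrix
of trace `2` or `-2`) that preserves the horosphere. -/
def OverlyDecorated.IsParallel (S : OverlyDecorated R3) : Prop :=
  ∀ A : SL2C, ((A : Matrix (Fin 2) (Fin 2) ℂ).trace = 2 ∨
    (A : Matrix (Fin 2) (Fin 2) ℂ).trace = -2) →
    actUpper A '' S.carrier = S.carrier → S.map (actUpper A) = S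

/-- The decorated horospheres of the upper half space model: horospheres with a parallel oriented
tangent line field. -/
def DecoratedHorosphere :=
  {S : OverlyDecorated R3 // IsHorosphere S.carrier ∧ S.IsOrientedLineField ∧ S.IsParallel}

/-! ## The smooth structure on decorated horospheres -/

/-- The unit tangent bundle of the unit sphere, as pairs of a point `u` and a unit vector
orthogonal to `u`. -/
def UTS2 := {x : R3 × R3 // x.1 ⬝ᵥ x.1 = 1 ∧ x.2 ⬝ᵥ x.2 = 1 ∧ x.1 ⬝ᵥ x.2 = 0}

/-- The coordinates of a decorated horosphere in `UTS² × ℝ`, described in the disc model. The point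
`u` is the centre of the horosphere on the sphere at infinity. The number `t` is the signed distance,
from the origin towards `u`, of the point `q` where the horosphere meets the diameter of the ball
through `u`, so that `q = tanh (t / 2) u`, and the horosphere is the sphere with diameter from `q` to `u`
without the point `u`. The vector `v` is the direction of the line field at `q`. -/
def HasCoordinates (D : DecoratedHorosphere) (x : UTS2 × ℝ) : Prop :=
  let u : R3 := x.1.1.1
  let v : R3 := x.1.1.2
  let q : R3 := Real.tanh (x.2 / 2) • u
  D.1.carrier = jMap '' {y | y ∈ disc ∧ (y - q) ⬝ᵥ (y - u) = 0} ∧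
  fderiv ℝ jMap q v ∈ D.1.dir (jMap q)

/-- A map from a manifold to `UTS² × ℝ` is smooth: it is smooth as a map to `ℝ³ × ℝ³ × ℝ`, which
contains `UTS² × ℝ` as an embedded submanifold. -/
def SmoothToUTS2 {M : Type*} [TopologicalSpace M] [ChartedSpace (Fin 2 → ℂ) M]
    (φ : M → UTS2 × ℝ) : Prop :=
  ContMDiff 𝓘(ℝ, Fin 2 → ℂ) 𝓘(ℝ, (R3 × R3) × ℝ) ∞ fun m => ((φ m).1.1, (φ m).2)

end SpinorHoro

end

open scoped MatrixGroups Manifold ContDiff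
open SpinorHoro

namespace SpinorHoro

/-! ## The null vector and the flag vector of a spinor -/

/-! Everything is read off from two vectors attached to a spinor κ = (ξ, η): the null vector p, with
time component T = |ξ|² + |η|², and the flag vector w, which is purely spatial, orthogonal to p and
of length 2T. Two maps are built from them and compared.

The first, `coords`, sends κ to (p/T, w/(2T), log T), with spatial parts understood. Spinors with
the same p differ by a phase l, and w turns in the plane orthogonal to p by l². Hence every unit
vector orthogonal to p is reached (`coords_surjective`), and by exactly two spinors κ and -κ
(`eq_or_eq_neg_of_nullVec_eq`). The formulas are visibly smooth where T > 0.

The second, `spinorHorosphere`, is the composition of the five geometric maps. Equivariance rests on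
one fact of linear algebra: Z(Aκ) is a positive multiple of A(Zκ) modulo Aκ
(`exists_spinorZ_mulVec`). So A carries the flag of κ to the flag of Aκ, and A preserves the
Minkowski form, hence horospheres and their tangent spaces. Since SL(2, ℂ) is transitive on nonzero
spinors, questions about decorated horospheres reduce to the spinor (1, 0), whose horosphere is the
plane z = 1. There a parallel field is invariant under all horizontal translations, hence constant.
The spinors over this plane are (ξ, 0) with |ξ| = 1, decorated by the direction iξ², so each
constant direction comes from exactly two of them, ±ξ (`IsDecorated.exists_spinor`,
`eq_or_eq_neg_one_smul_of_spinorHorosphere_eq`).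

Both maps thus descend to bijections out of spinors modulo sign, and the bijection Θ between UTS² ×
ℝ and decorated horospheres is one composed with the inverse of the other. With this choice Θ⁻¹ ∘ K
is `coords` itself, so smoothness is immediate. What remains is that Θ is the prescribed
correspondence, which is checked at the point of the horosphere on the diameter through its centre
(`iMap_image_hyperboloidHorosphere`, `fderiv_jMap_mem_spinorHorosphere_dir`). -/

/-- The null vector `g(f(κ))` of a spinor. -/
noncomputable def nullVec (κ : Fin 2 → ℂ) : Mink := hermEquiv (spinorSq κ)

/-- The flag vector `g(D_κ f(Z κ))` of a spinor. -/
noncomputable def flagVec (κ : Fin 2 → ℂ) : Mink := hermEquiv (spinorSqDeriv κ (spinorZ κ))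

theorem nullVec_eq (κ : Fin 2 → ℂ) : nullVec κ =
    ![(κ 0).re ^ 2 + (κ 0).im ^ 2 + (κ 1).re ^ 2 + (κ 1).im ^ 2,
      2 * ((κ 0).re * (κ 1).re + (κ 0).im * (κ 1).im),
      2 * ((κ 0).im * (κ 1).re - (κ 0).re * (κ 1).im),
      (κ 0).re ^ 2 + (κ 0).im ^ 2 - (κ 1).re ^ 2 - (κ 1).im ^ 2] := by
  ext i
  fin_cases i <;> simp [nullVec, hermEquiv, spinorSq_apply] <;> ring

theorem flagVec_eq (κ : Fin 2 → ℂ) : flagVec κ =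
    ![0, -4 * ((κ 0).re * (κ 0).im - (κ 1).re * (κ 1).im),
      2 * ((κ 0).re ^ 2 - (κ 0).im ^ 2 + (κ 1).re ^ 2 - (κ 1).im ^ 2),
      4 * ((κ 0).re * (κ 1).im + (κ 0).im * (κ 1).re)] := by
  ext i
  fin_cases i <;> simp [flagVec, hermEquiv, spinorSqDeriv_apply, spinorZ] <;> ring

theorem nullVec_zero_pos {κ : Fin 2 → ℂ} (hκ : κ ≠ 0) : 0 < nullVec κ 0 :=
  (hermEquiv_mem_lightCone (spinorSq_mem_hermCone hκ)).2

theorem minkInner_nullVec_self (κ : Fin 2 → ℂ) : minkInner (nullVec κ) (nullVec κ) = 0 := by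
  simp [minkInner, nullVec_eq]; ring

theorem minkInner_flagVec_nullVec (κ : Fin 2 → ℂ) : minkInner (flagVec κ) (nullVec κ) = 0 := by
  simp [minkInner, nullVec_eq, flagVec_eq]; ring

theorem nullVec_neg (κ : Fin 2 → ℂ) : nullVec (-κ) = nullVec κ := by
  simp [nullVec_eq]

theorem flagVec_neg (κ : Fin 2 → ℂ) : flagVec (-κ) = flagVec κ := by
  simp [flagVec_eq]

/-- A null vector corresponds to a positive semidefinite Hermitian matrix of rank one, so it is κκ*.
The phase of κ is normalised by making η real and positive; when the lower right entry vanishes so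
does the off-diagonal one, and ξ is made real and positive instead. -/
theorem exists_nullVec_eq {p : Mink} (hp : p ∈ lightCone) :
    ∃ κ : Fin 2 → ℂ, κ ≠ 0 ∧ nullVec κ = p := by
  obtain ⟨h, h0⟩ := hp
  simp only [minkInner] at h
  rcases lt_or_ge 0 (p 0 - p 3) with hb | hb
  · have hs : 0 < √((p 0 - p 3) / 2) := Real.sqrt_pos.2 (by linarith)
    have hss : √((p 0 - p 3) / 2) ^ 2 = (p 0 - p 3) / 2 := Real.sq_sqrt (by linarith)
    set r := √((p 0 - p 3) / 2)
    refine ⟨![⟨p 1 / (2 * r), p 2 / (2 * r)⟩, r], fun h => hs.ne' ?_, ?_⟩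
    · simpa using congrFun h 1
    · have hq : (p 1 / (2 * r)) ^ 2 + (p 2 / (2 * r)) ^ 2 = (p 0 + p 3) / 2 := by
        rw [div_pow, div_pow, mul_pow, hss]
        field_simp
        linear_combination -h
      ext i
      fin_cases i <;> simp [nullVec_eq]
      · linear_combination hq + hss
      · field_simp
      · field_simp
      · linear_combination hq - hss
  · have hs : 0 < √((p 0 + p 3) / 2) := Real.sqrt_pos.2 (by linarith)
    have hss : √((p 0 + p 3) / 2) ^ 2 = (p 0 + p 3) / 2 := Real.sq_sqrt (by linarith)
    have h03 : p 0 = p 3 := by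
      nlinarith [sq_nonneg (p 1), sq_nonneg (p 2)]
    have h1 : p 1 = 0 := by
      rw [h03] at h
      nlinarith [sq_nonneg (p 1), sq_nonneg (p 2)]
    have h2 : p 2 = 0 := by
      rw [h03] at h
      nlinarith [sq_nonneg (p 1), sq_nonneg (p 2)]
    set r := √((p 0 + p 3) / 2)
    refine ⟨![r, 0], fun h => hs.ne' ?_, ?_⟩
    · simpa using congrFun h 0
    · ext i
      fin_cases i <;> simp [nullVec_eq, h1, h2] <;> linarith

/-- Multiplying a spinor by a complex number of modulus one does not change its null vector. -/
theorem nullVec_smul {l : ℂ} (hl : Complex.normSq l = 1) (κ : Fin 2 → ℂ) :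
    nullVec (l • κ) = nullVec κ := by
  rw [Complex.normSq_apply] at hl
  ext i
  fin_cases i <;> simp [nullVec_eq]
  · linear_combination ((κ 0).re ^ 2 + (κ 0).im ^ 2 + (κ 1).re ^ 2 + (κ 1).im ^ 2) * hl
  · linear_combination ((κ 0).re * (κ 1).re + (κ 0).im * (κ 1).im) * hl
  · linear_combination ((κ 0).im * (κ 1).re - (κ 0).re * (κ 1).im) * hl
  · linear_combination ((κ 0).re ^ 2 + (κ 0).im ^ 2 - (κ 1).re ^ 2 - (κ 1).im ^ 2) * hl

/-- The null vector and the flag vector determine a spinor up to sign. -/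
theorem eq_or_eq_neg_of_nullVec_eq {κ μ : Fin 2 → ℂ} (hκ : κ ≠ 0) (hp : nullVec κ = nullVec μ)
    (hw : flagVec κ = flagVec μ) : μ = κ ∨ μ = -κ := by
  have hT := (nullVec_zero_pos hκ).ne'
  have p0 := congrFun hp 0
  have p1 := congrFun hp 1
  have p2 := congrFun hp 2
  have p3 := congrFun hp 3
  have w1 := congrFun hw 1
  have w2 := congrFun hw 2
  have w3 := congrFun hw 3
  simp [nullVec_eq, flagVec_eq] at p0 p1 p2 p3 w1 w2 w3 hT
  -- `ξ²`, `η²` and `ξ η` are determined by the two vectors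
  have key : ∀ ν : Fin 2 → ℂ, ∀ a b h s m : ℂ,
      a = ν 0 * star (ν 0) → b = ν 1 * star (ν 1) → h = ν 0 * star (ν 1) →
      s = ν 0 ^ 2 + star (ν 1) ^ 2 → m = ν 0 * ν 1 - star (ν 0 * ν 1) →
      ν 0 ^ 2 * (a + b) = s * a + m * h ∧ ν 1 ^ 2 * (a + b) = star s * b + m * star h ∧
      ν 0 * ν 1 * (a + b) = s * star h + m * b := by
    rintro ν _ _ _ _ _ rfl rfl rfl rfl rfl
    simp only [star_add, star_mul, star_star, star_pow]
    refine ⟨by ring, by ring, by ring⟩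
  obtain ⟨k1, k2, k3⟩ := key κ _ _ _ _ _ rfl rfl rfl rfl rfl
  obtain ⟨l1, l2, l3⟩ := key μ _ _ _ _ _ rfl rfl rfl rfl rfl
  -- The first three quantities are entries of κκ*, hence determined by p. The number ξ² + η̄² has
  -- real and imaginary parts proportional to the second and first spatial components of w, and ξη
  -- minus its conjugate is 2i Im(ξη), which the third component gives.
  have ea : μ 0 * star (μ 0) = κ 0 * star (κ 0) := by
    apply Complex.ext <;> simp <;> linarith
  have eb : μ 1 * star (μ 1) = κ 1 * star (κ 1) := by
    apply Complex.ext <;> simp <;> linarith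
  have eh : μ 0 * star (μ 1) = κ 0 * star (κ 1) := by
    apply Complex.ext <;> simp <;> linarith
  have es : μ 0 ^ 2 + star (μ 1) ^ 2 = κ 0 ^ 2 + star (κ 1) ^ 2 := by
    apply Complex.ext <;> (simp [pow_two]; linarith)
  have em : μ 0 * μ 1 - star (μ 0 * μ 1) = κ 0 * κ 1 - star (κ 0 * κ 1) := by
    apply Complex.ext
    · simp
    · simp
      linarith
  rw [ea, eb, eh, es, em, ← k1] at l1
  rw [ea, eb, eh, es, em, ← k2] at l2
  rw [ea, eb, eh, es, em, ← k3] at l3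
  have hab : κ 0 * star (κ 0) + κ 1 * star (κ 1) ≠ 0 := fun h => hT (by
    have := congrArg Complex.re h
    simp at this
    linarith)
  have q1 := mul_right_cancel₀ hab l1
  have q2 := mul_right_cancel₀ hab l2
  have q3 := mul_right_cancel₀ hab l3
  -- The squares fix ξ and η up to independent signs. Opposite signs would negate ξη, so they force
  -- ξη = 0, and the vanishing coordinate then absorbs the discrepancy.
  rcases sq_eq_sq_iff_eq_or_eq_neg.1 q1 with h0 | h0 <;>
  rcases sq_eq_sq_iff_eq_or_eq_neg.1 q2 with h1 | h1
  · left; ext i; fin_cases i <;> simp [h0, h1]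
  · rw [h0, h1] at q3
    have : κ 0 * κ 1 = 0 := by linear_combination -q3 / 2
    rcases mul_eq_zero.1 this with h | h
    · right; ext i; fin_cases i <;> simp [h0, h1, h]
    · left; ext i; fin_cases i <;> simp [h0, h1, h]
  · rw [h0, h1] at q3
    have : κ 0 * κ 1 = 0 := by linear_combination -q3 / 2
    rcases mul_eq_zero.1 this with h | h
    · left; ext i; fin_cases i <;> simp [h0, h1, h]
    · right; ext i; fin_cases i <;> simp [h0, h1, h]
  · right; ext i; fin_cases i <;> simp [h0, h1]

/-! ## The coordinates of a spinor in `UTS² × ℝ` -/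

/-- The spatial part of a vector of Minkowski space. -/
def spatial (p : Mink) : R3 := ![p 1, p 2, p 3]

/-- The coordinates in `(ℝ³ × ℝ³) × ℝ` of the decorated horosphere of a spinor. -/
noncomputable def ambientCoords (κ : Fin 2 → ℂ) : (R3 × R3) × ℝ :=
  (((nullVec κ 0)⁻¹ • spatial (nullVec κ), (2 * nullVec κ 0)⁻¹ • spatial (flagVec κ)),
    Real.log (nullVec κ 0))

/-- Since p is null its spatial part has length T, and w has no time component and length 2T; this
explains the two normalising factors. -/
theorem ambientCoords_mem {κ : Fin 2 → ℂ} (hκ : κ ≠ 0) :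
    (ambientCoords κ).1.1 ⬝ᵥ (ambientCoords κ).1.1 = 1 ∧
      (ambientCoords κ).1.2 ⬝ᵥ (ambientCoords κ).1.2 = 1 ∧
      (ambientCoords κ).1.1 ⬝ᵥ (ambientCoords κ).1.2 = 0 := by
  have hT := (nullVec_zero_pos hκ).ne'
  simp only [ambientCoords, smul_dotProduct, dotProduct_smul, smul_eq_mul]
  refine ⟨?_, ?_, ?_⟩
  · have : spatial (nullVec κ) ⬝ᵥ spatial (nullVec κ) = nullVec κ 0 ^ 2 := by
      simp [spatial, dotProduct, Fin.sum_univ_three, nullVec_eq]; ring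
    rw [this]; field_simp
  · have : spatial (flagVec κ) ⬝ᵥ spatial (flagVec κ) = 4 * nullVec κ 0 ^ 2 := by
      simp [spatial, dotProduct, Fin.sum_univ_three, nullVec_eq, flagVec_eq]; ring
    rw [this]; field_simp; norm_num
  · have : spatial (nullVec κ) ⬝ᵥ spatial (flagVec κ) = 0 := by
      simp [spatial, dotProduct, Fin.sum_univ_three, nullVec_eq, flagVec_eq]; ring
    rw [this]; simp

/-- The coordinates in `UTS² × ℝ` of the decorated horosphere of a spinor. -/
noncomputable def coords (κ : Spinor) : UTS2 × ℝ :=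
  (⟨(ambientCoords κ).1, ambientCoords_mem (Spinor.ne_zero κ)⟩, (ambientCoords κ).2)

theorem coords_neg_one_smul (κ : Spinor) : coords ((-1 : ℤˣ) • κ) = coords κ := by
  have h : ambientCoords ((-1 : ℤˣ) • κ : Spinor) = ambientCoords κ := by
    simp only [ambientCoords, Spinor.coe_neg_one_smul, nullVec_neg, flagVec_neg]
  refine Prod.ext (Subtype.ext ?_) ?_
  · exact congrArg (fun x : (R3 × R3) × ℝ => x.1) h
  · exact congrArg (fun x : (R3 × R3) × ℝ => x.2) h

theorem eq_or_eq_neg_one_smul_of_coords_eq {κ μ : Spinor} (h : coords κ = coords μ) :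
    μ = κ ∨ μ = (-1 : ℤˣ) • κ := by
  have h1 : (ambientCoords κ).1 = (ambientCoords μ).1 :=
    congrArg (fun x : UTS2 × ℝ => x.1.1) h
  have h2 : (ambientCoords κ).2 = (ambientCoords μ).2 :=
    congrArg (fun x : UTS2 × ℝ => x.2) h
  have hκ := nullVec_zero_pos (Spinor.ne_zero κ)
  have hμ := nullVec_zero_pos (Spinor.ne_zero μ)
  have hT : nullVec κ 0 = nullVec μ 0 := Real.log_injOn_pos hκ hμ h2
  have hu := congrArg Prod.fst h1
  have hv := congrArg Prod.snd h1
  simp only [ambientCoords, hT] at hu hv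
  have hu' := smul_right_injective R3 (inv_ne_zero hμ.ne') hu
  have hv' := smul_right_injective R3 (inv_ne_zero (mul_ne_zero two_ne_zero hμ.ne')) hv
  have hp : nullVec κ = nullVec μ := by
    have e1 := congrFun hu' 0
    have e2 := congrFun hu' 1
    have e3 := congrFun hu' 2
    ext i
    fin_cases i
    exacts [hT, e1, e2, e3]
  have hw : flagVec κ = flagVec μ := by
    have e1 := congrFun hv' 0
    have e2 := congrFun hv' 1
    have e3 := congrFun hv' 2
    ext i
    fin_cases i
    exacts [by simp [flagVec_eq], e1, e2, e3]
  exact (eq_or_eq_neg_of_nullVec_eq (Spinor.ne_zero κ) hp hw).imp (fun h => Subtype.ext h)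
    fun h => Subtype.ext (h.trans (Spinor.coe_neg_one_smul κ).symm)

theorem coords_surjective : Function.Surjective coords := by
  rintro ⟨⟨⟨u, v⟩, hu, hv, huv⟩, t⟩
  simp only at hu hv huv
  have hT := Real.exp_pos t
  obtain ⟨κ, hκ, hp⟩ := exists_nullVec_eq
    (p := ![Real.exp t, Real.exp t * u 0, Real.exp t * u 1, Real.exp t * u 2]) (by
      simp only [dotProduct, Fin.sum_univ_three] at hu
      refine ⟨?_, by simpa using hT⟩
      simp [minkInner]
      linear_combination (-Real.exp t ^ 2) * hu)
  have hp0 : nullVec κ 0 = Real.exp t := by rw [hp]; rfl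
  have hui : (nullVec κ 0)⁻¹ • spatial (nullVec κ) = u := by
    rw [hp]
    ext i
    fin_cases i <;> simp [spatial]
  set T := nullVec κ 0 with hTdef
  have hT0 : T ≠ 0 := by rw [hp0]; exact hT.ne'
  -- The spatial part of the flag vector of the spinor multiplied by a square root of i. It is the
  -- flag vector turned by a right angle about u, so u, v₁, v₂ form an orthonormal frame.
  let w₂ : R3 := ![-2 * ((κ 0).re ^ 2 - (κ 0).im ^ 2) + 2 * ((κ 1).re ^ 2 - (κ 1).im ^ 2),
    -4 * ((κ 0).re * (κ 0).im + (κ 1).re * (κ 1).im),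
    4 * ((κ 0).re * (κ 1).re - (κ 0).im * (κ 1).im)]
  obtain ⟨m1, m2, m3⟩ := ambientCoords_mem hκ
  simp only [ambientCoords, ← hTdef, hui] at m1 m2 m3
  set v₁ := (2 * T)⁻¹ • spatial (flagVec κ) with hv₁
  set v₂ := (2 * T)⁻¹ • w₂ with hv₂
  have m4 : v₂ ⬝ᵥ v₂ = 1 := by
    have : w₂ ⬝ᵥ w₂ = 4 * T ^ 2 := by
      simp [w₂, T, dotProduct, Fin.sum_univ_three, nullVec_eq]; ring
    rw [hv₂, smul_dotProduct, dotProduct_smul, this, smul_eq_mul, smul_eq_mul]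
    field_simp; norm_num
  have m5 : u ⬝ᵥ v₂ = 0 := by
    have : spatial (nullVec κ) ⬝ᵥ w₂ = 0 := by
      simp [w₂, spatial, dotProduct, Fin.sum_univ_three, nullVec_eq]; ring
    rw [hv₂, ← hui, smul_dotProduct, dotProduct_smul, this]; simp
  have m6 : v₁ ⬝ᵥ v₂ = 0 := by
    have : spatial (flagVec κ) ⬝ᵥ w₂ = 0 := by
      simp [w₂, spatial, dotProduct, Fin.sum_univ_three, flagVec_eq]; ring
    rw [hv₁, hv₂, smul_dotProduct, dotProduct_smul, this]; simp
  let M : Matrix (Fin 3) (Fin 3) ℝ := Matrix.of ![u, v₁, v₂]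
  have hM : M * Mᵀ = 1 := by
    ext i j
    have : (M * Mᵀ) i j = M i ⬝ᵥ M j := rfl
    rw [this]
    have hc := fun x y : R3 => dotProduct_comm x y
    fin_cases i <;> fin_cases j
    exacts [m1, m3, m5, (hc _ _).trans m3, m2, m6, (hc _ _).trans m5, (hc _ _).trans m6, m4]
  -- Expansion of v in the orthonormal frame; there is no u term because v is orthogonal to u.
  have hexp : v = (v₁ ⬝ᵥ v) • v₁ + (v₂ ⬝ᵥ v) • v₂ := by
    have h : Mᵀ *ᵥ (M *ᵥ v) = v := by
      rw [Matrix.mulVec_mulVec, mul_eq_one_comm.1 hM, Matrix.one_mulVec]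
    have h' : M *ᵥ v = ![0, v₁ ⬝ᵥ v, v₂ ⬝ᵥ v] := by
      ext i
      fin_cases i
      exacts [huv, rfl, rfl]
    rw [h'] at h
    conv_lhs => rw [← h]
    ext i
    simp [Matrix.mulVec, dotProduct, Fin.sum_univ_three, M]
    ring
  set c := v₁ ⬝ᵥ v
  set s := v₂ ⬝ᵥ v
  have hcs : c ^ 2 + s ^ 2 = 1 := by
    rw [hexp] at hv
    simp only [add_dotProduct, dotProduct_add, smul_dotProduct, dotProduct_smul, m2, m4, m6,
      dotProduct_comm v₂ v₁, smul_eq_mul] at hv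
    linear_combination hv
  -- The flag vector is quadratic in the spinor, so a phase l turns it by l²; the required rotation
  -- is c + is, hence the square root.
  obtain ⟨l, hl⟩ := IsAlgClosed.exists_pow_nat_eq (⟨c, s⟩ : ℂ) two_pos
  have hre : l.re ^ 2 - l.im ^ 2 = c := by
    have := congrArg Complex.re hl
    simp [pow_two] at this
    linear_combination this
  have him : 2 * l.re * l.im = s := by
    have := congrArg Complex.im hl
    simp [pow_two] at this
    linear_combination this
  have hn : Complex.normSq l = 1 := by
    have h1 : Complex.normSq l ^ 2 = 1 := by
      rw [Complex.normSq_apply, ← hcs, ← hre, ← him]; ring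
    exact (pow_eq_one_iff_of_nonneg (Complex.normSq_nonneg l) two_ne_zero).1 h1
  have hl0 : l ≠ 0 := by
    rintro rfl
    simp at hn
  have hw : spatial (flagVec (l • κ)) = c • spatial (flagVec κ) + s • w₂ := by
    rw [← hre, ← him]
    ext i
    fin_cases i <;> simp [spatial, flagVec_eq, w₂] <;> ring
  refine ⟨⟨l • κ, smul_ne_zero hl0 hκ⟩, Prod.ext (Subtype.ext (Prod.ext ?_ ?_)) ?_⟩
  · simp only [coords, ambientCoords, nullVec_smul hn]
    exact hui
  · simp only [coords, ambientCoords, nullVec_smul hn, hw]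
    rw [← hTdef, smul_add, smul_comm _ c, smul_comm _ s]
    exact hexp.symm
  · simp only [coords, ambientCoords, nullVec_smul hn]
    rw [← hTdef, hp0, Real.log_exp]

/-! ## Smoothness of the coordinates -/

theorem contDiffAt_ambientCoords {κ : Fin 2 → ℂ} (hκ : κ ≠ 0) :
    ContDiffAt ℝ ∞ ambientCoords κ := by
  have hre : ∀ i, ContDiff ℝ ∞ fun κ : Fin 2 → ℂ => (κ i).re := fun i =>
    Complex.reCLM.contDiff.comp (contDiff_apply ℝ ℂ i)
  have him : ∀ i, ContDiff ℝ ∞ fun κ : Fin 2 → ℂ => (κ i).im := fun i =>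
    Complex.imCLM.contDiff.comp (contDiff_apply ℝ ℂ i)
  have hp : ∀ i, ContDiff ℝ ∞ fun κ => nullVec κ i := by
    intro i
    have r0 := hre 0
    have r1 := hre 1
    have i0 := him 0
    have i1 := him 1
    simp only [nullVec_eq]
    fin_cases i <;> simp <;> fun_prop
  have hw : ∀ i, ContDiff ℝ ∞ fun κ => flagVec κ i := by
    intro i
    have r0 := hre 0
    have r1 := hre 1
    have i0 := him 0
    have i1 := him 1
    simp only [flagVec_eq]
    fin_cases i <;> simp <;> fun_prop
  have hT := (nullVec_zero_pos hκ).ne'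
  have hs : ∀ q : (Fin 2 → ℂ) → Mink, (∀ i, ContDiff ℝ ∞ fun κ => q κ i) →
      ContDiffAt ℝ ∞ (fun κ => spatial (q κ)) κ := by
    intro q hq
    refine contDiffAt_pi.2 fun i => ?_
    fin_cases i
    exacts [(hq 1).contDiffAt, (hq 2).contDiffAt, (hq 3).contDiffAt]
  refine ContDiffAt.prodMk (ContDiffAt.prodMk ?_ ?_) ?_
  · exact ((hp 0).contDiffAt.inv hT).smul (hs _ hp)
  · exact ((contDiffAt_const.mul (hp 0).contDiffAt).inv (mul_ne_zero two_ne_zero hT)).smul (hs _ hw)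
  · exact (hp 0).contDiffAt.log hT

theorem smoothToUTS2_coords : SmoothToUTS2 coords := fun κ =>
  ((contDiffAt_ambientCoords (Spinor.ne_zero κ)).contMDiffAt.comp κ
    (contMDiff_subtype_val κ) : _)

/-- The coordinates on `(ℂ² ∖ {0}) / {±1}`. -/
noncomputable def coordsModSign : SpinorModSign → UTS2 × ℝ :=
  Quotient.lift coords (by
    rintro _ μ ⟨e, rfl⟩
    rcases Int.units_eq_one_or e with rfl | rfl
    · exact congrArg coords (one_smul _ μ)
    · exact coords_neg_one_smul μ)

theorem modSign_eq_iff {κ μ : Spinor} :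
    modSign κ = modSign μ ↔ κ = μ ∨ κ = (-1 : ℤˣ) • μ := by
  refine Quotient.eq.trans ?_
  change (∃ e : ℤˣ, e • μ = κ) ↔ _
  constructor
  · rintro ⟨e, rfl⟩
    rcases Int.units_eq_one_or e with rfl | rfl
    · exact Or.inl (one_smul _ μ)
    · exact Or.inr rfl
  · rintro (rfl | rfl)
    exacts [⟨1, one_smul _ _⟩, ⟨-1, rfl⟩]

theorem coordsModSign_bijective : Function.Bijective coordsModSign := by
  constructor
  · intro x y
    induction x using Quotient.inductionOn with
    | h κ =>
      induction y using Quotient.inductionOn with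
      | h μ => exact fun h => modSign_eq_iff.2 (eq_or_eq_neg_one_smul_of_coords_eq h.symm)
  · intro x
    obtain ⟨κ, rfl⟩ := coords_surjective x
    exact ⟨modSign κ, rfl⟩

/-- Smoothness upstairs passes down because a chart of the quotient at x is a local section followed
by a chart at a representative: the two maps have the same expression in charts. -/
theorem smoothToUTS2_coordsModSign : SmoothToUTS2 coordsModSign := by
  intro x
  have hf : IsLocalHomeomorph (Quotient.mk (MulAction.orbitRel ℤˣ Spinor)) :=
    isQuotientCoveringMap_quotientMk_of_properlyDiscontinuousSMul.isCoveringMap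
      |>.isLocalHomeomorph
  have hsurj := Quotient.mk_surjective (s := MulAction.orbitRel ℤˣ Spinor)
  -- This must be the very representative from which the chart at x is built; an arbitrary one would
  -- not make `hchart` hold by `rfl`.
  set κ : Spinor := hsurj.hasRightInverse.choose x
  have hκ : Quotient.mk _ κ = x := hsurj.hasRightInverse.choose_spec x
  have hchart : chartAt (Fin 2 → ℂ) x = (hf.localInverseAt κ).trans (chartAt (Fin 2 → ℂ) κ) := rfl
  have hsymm : ∀ y, (extChartAt 𝓘(ℝ, Fin 2 → ℂ) x).symm y =
      Quotient.mk _ ((extChartAt 𝓘(ℝ, Fin 2 → ℂ) κ).symm y) := by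
    intro y
    simp [extChartAt, hchart]
  have hpt : extChartAt 𝓘(ℝ, Fin 2 → ℂ) x x = extChartAt 𝓘(ℝ, Fin 2 → ℂ) κ κ := by
    have : hf.localInverseAt κ x = κ := by
      rw [← hκ]
      exact hf.localInverseAt_apply_self
    simp [extChartAt, hchart, this]
  refine contMDiffAt_iff.2 ⟨Continuous.continuousAt ?_, ?_⟩
  · exact continuous_coinduced_dom.2 smoothToUTS2_coords.continuous
  · have h := (contMDiffAt_iff.1 (smoothToUTS2_coords κ)).2
    rw [hpt]
    simp only [Function.comp_def, hsymm]
    exact h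

/-! ## Images of decorated sets under maps -/

section Map

variable {E E' E'' : Type*} [NormedAddCommGroup E] [NormedSpace ℝ E]
  [NormedAddCommGroup E'] [NormedSpace ℝ E'] [NormedAddCommGroup E''] [NormedSpace ℝ E'']

theorem fderiv_mem_tangentVectors {S : Set E} {q w : E} {φ : E → E'}
    (hφ : DifferentiableAt ℝ φ q) (hw : w ∈ tangentVectors S q) :
    fderiv ℝ φ q w ∈ tangentVectors (φ '' S) (φ q) := by
  obtain ⟨γ, h0, hS, hd⟩ := hw
  refine ⟨φ ∘ γ, by simp [h0], hS.mono fun s hs => Set.mem_image_of_mem φ hs, ?_⟩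
  subst h0
  exact hφ.hasFDerivAt.comp_hasDerivAt 0 hd

/-- Maps that agree on a set have the same derivative in the directions tangent to the set. -/
theorem fderiv_apply_congr_of_eqOn {S : Set E} {q w : E} {φ ψ : E → E'}
    (hφ : DifferentiableAt ℝ φ q) (hψ : DifferentiableAt ℝ ψ q) (h : Set.EqOn φ ψ S)
    (hw : w ∈ tangentVectors S q) : fderiv ℝ φ q w = fderiv ℝ ψ q w := by
  obtain ⟨γ, h0, hS, hd⟩ := hw
  subst h0
  have h1 := hφ.hasFDerivAt.comp_hasDerivAt 0 hd
  have h2 := hψ.hasFDerivAt.comp_hasDerivAt 0 hd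
  exact h1.unique (h2.congr_of_eventuallyEq (hS.mono fun s hs => h hs))

namespace OverlyDecorated

/-- All directing vectors are tangent to the underlying set. -/
def IsTangent (S : OverlyDecorated E) : Prop :=
  ∀ q ∈ S.carrier, S.dir q ⊆ tangentVectors S.carrier q

theorem smul_mem_tangentVectors {S : Set E} {q w : E} (c : ℝ) (hw : w ∈ tangentVectors S q) :
    c • w ∈ tangentVectors S q := by
  obtain ⟨γ, h0, hS, hd⟩ := hw
  have hc : HasDerivAt (fun s : ℝ => c * s) c 0 := by
    simpa using (hasDerivAt_id (0 : ℝ)).const_mul c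
  refine ⟨fun s => γ (c * s), by simpa using h0, ?_, ?_⟩
  · have h := hc.continuousAt.tendsto
    rw [mul_zero] at h
    exact h.eventually hS
  · have hd' : HasDerivAt γ w (c * 0) := by simpa using hd
    exact hd'.scomp (0 : ℝ) hc

theorem IsOrientedLineField.isTangent {S : OverlyDecorated E} (hS : S.IsOrientedLineField) :
    S.IsTangent := by
  intro q hq w hw
  obtain ⟨w', hw', -, h⟩ := hS.1 q hq
  rw [h] at hw
  obtain ⟨c, -, rfl⟩ := hw
  exact smul_mem_tangentVectors c hw'

theorem map_map {φ : E → E'} {ψ : E' → E''} (S : OverlyDecorated E)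
    (hφ : ∀ q ∈ S.carrier, DifferentiableAt ℝ φ q)
    (hψ : ∀ q ∈ S.carrier, DifferentiableAt ℝ ψ (φ q)) :
    (S.map φ).map ψ = S.map (ψ ∘ φ) := by
  have hd : ∀ q ∈ S.carrier, ∀ w, fderiv ℝ (ψ ∘ φ) q w = fderiv ℝ ψ (φ q) (fderiv ℝ φ q w) := by
    intro q hq w
    rw [fderiv_comp q (hψ q hq) (hφ q hq)]
    rfl
  ext y
  · simp [map]
  · constructor
    · rintro ⟨_, -, rfl, _, ⟨q, hq, rfl, w, hw, rfl⟩, rfl⟩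
      exact ⟨q, hq, rfl, w, hw, (hd q hq w).symm⟩
    · rintro ⟨q, hq, rfl, w, hw, rfl⟩
      exact ⟨φ q, ⟨q, hq, rfl⟩, rfl, _, ⟨q, hq, rfl, w, hw, rfl⟩, hd q hq w⟩

/-- Maps that agree only on the carrier may have different derivatives in the ambient space, and
tangency of the field is what makes the difference harmless. This is needed because the formulas for
the models, such as `jMap ∘ iMap` and `toUpper`, agree on the hyperboloid but not around it. -/
theorem map_congr {φ ψ : E → E'} {S : OverlyDecorated E} (hS : S.IsTangent)
    (hφ : ∀ q ∈ S.carrier, DifferentiableAt ℝ φ q) (hψ : ∀ q ∈ S.carrier, DifferentiableAt ℝ ψ q)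
    (h : Set.EqOn φ ψ S.carrier) : S.map φ = S.map ψ := by
  have hd : ∀ q ∈ S.carrier, ∀ w ∈ S.dir q, fderiv ℝ φ q w = fderiv ℝ ψ q w := fun q hq w hw =>
    fderiv_apply_congr_of_eqOn (hφ q hq) (hψ q hq) h (hS q hq hw)
  ext y x
  · exact iff_of_eq (congrArg (y ∈ ·) (Set.image_congr h))
  · constructor
    · rintro ⟨q, hq, rfl, w, hw, rfl⟩
      exact ⟨q, hq, (h hq).symm, w, hw, hd q hq w hw⟩
    · rintro ⟨q, hq, rfl, w, hw, rfl⟩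
      exact ⟨q, hq, h hq, w, hw, (hd q hq w hw).symm⟩

theorem map_eq_self {φ : E → E} {S : OverlyDecorated E} (hS : S.IsTangent)
    (hS' : ∀ q ∉ S.carrier, S.dir q = ∅)
    (hφ : ∀ q ∈ S.carrier, DifferentiableAt ℝ φ q) (h : ∀ q ∈ S.carrier, φ q = q) :
    S.map φ = S := by
  rw [map_congr hS hφ (ψ := id) (fun q _ => differentiableAt_id) h]
  ext y x
  · simp [map]
  · constructor
    · rintro ⟨q, hq, rfl, w, hw, rfl⟩
      simpa using hw
    · intro hx
      have hy : y ∈ S.carrier := by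
        by_contra hy
        rw [hS' y hy] at hx
        exact hx
      exact ⟨y, hy, rfl, x, hx, by simp⟩

theorem map_dir_of_injOn {φ : E → E'} {S : OverlyDecorated E} (h : Set.InjOn φ S.carrier)
    {q : E} (hq : q ∈ S.carrier) : (S.map φ).dir (φ q) = fderiv ℝ φ q '' S.dir q := by
  ext x
  constructor
  · rintro ⟨q', hq', he, w, hw, rfl⟩
    obtain rfl := h hq' hq he
    exact ⟨w, hw, rfl⟩
  · rintro ⟨w, hw, rfl⟩
    exact ⟨q, hq, rfl, w, hw, rfl⟩

/-- A map with a differentiable left inverse takes oriented line fields to oriented line fields. -/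
theorem IsOrientedLineField.map {φ : E → E'} {ψ : E' → E} {S : OverlyDecorated E}
    (hS : S.IsOrientedLineField)
    (hφ : ∀ q ∈ S.carrier, DifferentiableAt ℝ φ q)
    (hψ : ∀ q ∈ S.carrier, DifferentiableAt ℝ ψ (φ q)) (h : ∀ q ∈ S.carrier, ψ (φ q) = q) :
    (S.map φ).IsOrientedLineField := by
  have hinj : Set.InjOn φ S.carrier := Set.LeftInvOn.injOn (f₁' := ψ) h
  constructor
  · rintro _ ⟨q, hq, rfl⟩
    obtain ⟨w, hw, hw0, hdir⟩ := hS.1 q hq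
    refine ⟨fderiv ℝ φ q w, fderiv_mem_tangentVectors (hφ q hq) hw, fun h0 => hw0 ?_, ?_⟩
    · have h1 : fderiv ℝ (ψ ∘ φ) q w = fderiv ℝ id q w :=
        fderiv_apply_congr_of_eqOn ((hψ q hq).comp q (hφ q hq)) differentiableAt_id h hw
      rw [fderiv_comp q (hψ q hq) (hφ q hq)] at h1
      simpa [h0] using h1.symm
    · rw [map_dir_of_injOn hinj hq, hdir]
      ext x
      constructor
      · rintro ⟨_, ⟨c, hc, rfl⟩, rfl⟩
        exact ⟨c, hc, by simp⟩
      · rintro ⟨c, hc, rfl⟩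
        exact ⟨c • w, ⟨c, hc, rfl⟩, by simp⟩
  · intro y hy
    refine Set.eq_empty_iff_forall_notMem.2 ?_
    rintro _ ⟨q, hq, rfl, -⟩
    exact hy ⟨q, hq, rfl⟩

end OverlyDecorated

end Map

/-! ## Minkowski space and the hyperboloid -/

theorem minkInner_comm (x y : Mink) : minkInner x y = minkInner y x := by
  simp only [minkInner]; ring

theorem minkInner_add_right (x y z : Mink) :
    minkInner x (y + z) = minkInner x y + minkInner x z := by
  simp [minkInner]; ring

theorem minkInner_smul_right (r : ℝ) (x y : Mink) : minkInner x (r • y) = r * minkInner x y := by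
  simp [minkInner]; ring

theorem minkInner_add_left (x y z : Mink) :
    minkInner (x + y) z = minkInner x z + minkInner y z := by
  simp [minkInner]; ring

theorem minkInner_smul_left (r : ℝ) (x y : Mink) : minkInner (r • x) y = r * minkInner x y := by
  simp [minkInner]; ring

theorem hasDerivAt_minkInner {γ δ : ℝ → Mink} {v w : Mink} {s : ℝ} (hγ : HasDerivAt γ v s)
    (hδ : HasDerivAt δ w s) :
    HasDerivAt (fun s => minkInner (γ s) (δ s)) (minkInner v (δ s) + minkInner (γ s) w) s := by
  have h := fun i => (hasDerivAt_pi.1 hγ i).mul (hasDerivAt_pi.1 hδ i)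
  convert! (((h 0).sub (h 1)).sub (h 2)).sub (h 3) using 1
  simp only [minkInner]; ring

/-- The vectors tangent to the horosphere `⟨x, p⟩ = 1` of the hyperboloid. -/
theorem mem_tangentVectors_horosphere {p x w : Mink} (hp : minkInner p p = 0)
    (hx : x ∈ hyperboloid) (hxp : minkInner x p = 1) :
    w ∈ tangentVectors {x | x ∈ hyperboloid ∧ minkInner x p = 1} x ↔
      minkInner x w = 0 ∧ minkInner w p = 0 := by
  constructor
  · rintro ⟨γ, rfl, hS, hd⟩
    have h1 := (hasDerivAt_minkInner hd hd).unique
      ((hasDerivAt_const (0 : ℝ) (1 : ℝ)).congr_of_eventuallyEq (hS.mono fun s hs => hs.1.1))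
    have h2 := (hasDerivAt_minkInner hd (hasDerivAt_const (0 : ℝ) p)).unique
      ((hasDerivAt_const (0 : ℝ) (1 : ℝ)).congr_of_eventuallyEq (hS.mono fun s hs => hs.2))
    rw [minkInner_comm w] at h1
    have h3 : minkInner (γ 0) 0 = 0 := by simp [minkInner]
    exact ⟨by linarith, by linarith⟩
  · rintro ⟨h1, h2⟩
    -- The quadratic term in the null direction p cancels s²⟨w, w⟩, because ⟨x, p⟩ = 1, and leaves
    -- the product with p unchanged. So this parabola stays exactly on both hypersurfaces.
    have hd : HasDerivAt (fun s : ℝ => x + s • w + (s ^ 2 * (-minkInner w w / 2)) • p) w 0 := by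
      have e1 := ((hasDerivAt_id (0 : ℝ)).smul_const w).const_add x
      have e2 := (((hasDerivAt_id (0 : ℝ)).pow 2).mul_const (-minkInner w w / 2)).smul_const p
      convert! e1.add e2 using 1
      simp
    refine ⟨_, by simp, ?_, hd⟩
    have hpos : ∀ᶠ s : ℝ in 𝓝 0, 0 < (x + s • w + (s ^ 2 * (-minkInner w w / 2)) • p) 0 := by
      refine ((continuous_apply 0).continuousAt.comp hd.continuousAt).eventually_const_lt ?_
      simpa using hx.2
    refine hpos.mono fun s hs => ⟨⟨?_, hs⟩, ?_⟩
    · simp only [minkInner_add_right, minkInner_add_left, minkInner_smul_right,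
        minkInner_smul_left, minkInner_comm p, minkInner_comm w x, h1, h2, hp, hxp, hx.1]
      ring
    · simp only [minkInner_add_left, minkInner_smul_left, h2, hp, hxp]
      ring

/-- The horosphere of a spinor in the hyperboloid model, with its line field. -/
noncomputable def hyperboloidHorosphere (κ : Spinor) : OverlyDecorated Mink :=
  mapH (mapG (mapF κ))

theorem mem_hyperboloidHorosphere_carrier {κ : Spinor} {x : Mink} :
    x ∈ (hyperboloidHorosphere κ).carrier ↔ x ∈ hyperboloid ∧ minkInner x (nullVec κ) = 1 :=
  Iff.rfl

/-- The tangent vector at `x` to the horosphere of `κ` given by the flag of `κ`. -/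
noncomputable def lineVec (κ : Spinor) (x : Mink) : Mink :=
  flagVec κ + (-minkInner x (flagVec κ)) • nullVec κ

theorem lineVec_tangent {κ : Spinor} {x : Mink} (hx : x ∈ (hyperboloidHorosphere κ).carrier) :
    minkInner x (lineVec κ x) = 0 ∧ minkInner (lineVec κ x) (nullVec κ) = 0 := by
  obtain ⟨-, hxp⟩ := hx
  change minkInner x (nullVec κ) = 1 at hxp
  constructor
  · rw [lineVec, minkInner_add_right, minkInner_smul_right, hxp]; ring
  · rw [lineVec, minkInner_add_left, minkInner_smul_left, minkInner_nullVec_self,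
      minkInner_flagVec_nullVec]; ring

theorem lineVec_mem_tangentVectors {κ : Spinor} {x : Mink}
    (hx : x ∈ (hyperboloidHorosphere κ).carrier) :
    lineVec κ x ∈ tangentVectors (hyperboloidHorosphere κ).carrier x :=
  (mem_tangentVectors_horosphere (minkInner_nullVec_self κ) hx.1 hx.2).2 (lineVec_tangent hx)

/-- A vector a p + b w of the half-plane is tangent exactly when it is orthogonal to x. As ⟨x, p⟩ =
1, this forces a = -b⟨x, w⟩, so the half-plane meets the tangent space in a single open ray. -/
theorem hyperboloidHorosphere_dir {κ : Spinor} {x : Mink}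
    (hx : x ∈ (hyperboloidHorosphere κ).carrier) :
    (hyperboloidHorosphere κ).dir x = {w | ∃ c : ℝ, 0 < c ∧ w = c • lineVec κ x} := by
  have hpos : (mapG (mapF κ)).pos = halfPlane (nullVec κ) (flagVec κ) := by
    ext w
    constructor
    · rintro ⟨_, ⟨a, b, hb, rfl⟩, rfl⟩
      exact ⟨a, b, hb, by simp [nullVec, flagVec]⟩
    · rintro ⟨a, b, hb, rfl⟩
      exact ⟨_, ⟨a, b, hb, rfl⟩, by simp [nullVec, flagVec]⟩
  ext w
  constructor
  · rintro ⟨-, -, hw, hwt⟩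
    rw [hpos] at hw
    obtain ⟨a, b, hb, rfl⟩ := hw
    have h := ((mem_tangentVectors_horosphere (minkInner_nullVec_self κ) hx.1 hx.2).1 hwt).1
    have hxp : minkInner x (nullVec κ) = 1 := hx.2
    rw [minkInner_add_right, minkInner_smul_right, minkInner_smul_right, hxp] at h
    refine ⟨b, hb, ?_⟩
    have ha : a = b * -minkInner x (flagVec κ) := by linarith
    rw [lineVec, smul_add, smul_smul, ← ha, add_comm]
  · rintro ⟨c, hc, rfl⟩
    refine ⟨hx.1, hx.2, ?_,
      OverlyDecorated.smul_mem_tangentVectors c (lineVec_mem_tangentVectors hx)⟩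
    rw [hpos]
    exact ⟨c * -minkInner x (flagVec κ), c, hc, by rw [lineVec, smul_add, smul_smul, add_comm]⟩

theorem hyperboloidHorosphere_dir_of_notMem {κ : Spinor} {x : Mink}
    (hx : x ∉ (hyperboloidHorosphere κ).carrier) : (hyperboloidHorosphere κ).dir x = ∅ :=
  Set.eq_empty_iff_forall_notMem.2 fun _ hw => hx ⟨hw.1, hw.2.1⟩

theorem hyperboloidHorosphere_isTangent (κ : Spinor) : (hyperboloidHorosphere κ).IsTangent := by
  intro x hx w hw
  rw [hyperboloidHorosphere_dir hx] at hw
  obtain ⟨c, -, rfl⟩ := hw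
  exact OverlyDecorated.smul_mem_tangentVectors c (lineVec_mem_tangentVectors hx)

/-! ## The action on Minkowski space -/

theorem actHerm_add (A : SL2C) (S T : Herm) : actHerm A (S + T) = actHerm A S + actHerm A T :=
  Subtype.ext (by simp [actHerm, mul_add, add_mul])

theorem actHerm_smul (A : SL2C) (r : ℝ) (S : Herm) : actHerm A (r • S) = r • actHerm A S :=
  Subtype.ext (by simp [actHerm])

theorem actHerm_mul (A B : SL2C) (S : Herm) : actHerm (A * B) S = actHerm A (actHerm B S) :=
  Subtype.ext (by simp [actHerm, mul_assoc])

theorem actHerm_one (S : Herm) : actHerm 1 S = S :=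
  Subtype.ext (by simp [actHerm])

theorem actMink_add (A : SL2C) (x y : Mink) : actMink A (x + y) = actMink A x + actMink A y := by
  simp [actMink, actHerm_add]

theorem actMink_smul (A : SL2C) (r : ℝ) (x : Mink) : actMink A (r • x) = r • actMink A x := by
  simp [actMink, actHerm_smul]

theorem actMink_mul (A B : SL2C) (x : Mink) : actMink (A * B) x = actMink A (actMink B x) := by
  simp [actMink, actHerm_mul]

theorem actMink_one (x : Mink) : actMink 1 x = x := by
  simp [actMink, actHerm_one]

/-- The action of a matrix on Minkowski space as a continuous linear map. -/
noncomputable def actMinkCLM (A : SL2C) : Mink →L[ℝ] Mink :=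
  LinearMap.toContinuousLinearMap ⟨⟨actMink A, actMink_add A⟩, actMink_smul A⟩

theorem coe_actMinkCLM (A : SL2C) : ⇑(actMinkCLM A) = actMink A := rfl

theorem fderiv_actMink (A : SL2C) (x : Mink) : fderiv ℝ (actMink A) x = actMinkCLM A :=
  (actMinkCLM A).fderiv

theorem differentiableAt_actMink (A : SL2C) (x : Mink) : DifferentiableAt ℝ (actMink A) x :=
  (actMinkCLM A).differentiableAt

/-- The source of invariance: S ↦ ASA* preserves determinants when det A = 1, and polarisation then
gives the whole Minkowski form. -/
theorem minkInner_self_eq_det (x : Mink) :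
    (minkInner x x : ℂ) = 4 * (hermEquiv.symm x : Herm).1.det := by
  rw [Matrix.det_fin_two]
  apply Complex.ext <;> simp [hermEquiv, herm, minkInner] <;> ring

theorem minkInner_actMink_self (A : SL2C) (x : Mink) :
    minkInner (actMink A x) (actMink A x) = minkInner x x := by
  have h : (minkInner (actMink A x) (actMink A x) : ℂ) = minkInner x x := by
    rw [minkInner_self_eq_det, minkInner_self_eq_det]
    simp [actMink, actHerm, Matrix.star_eq_conjTranspose, Matrix.det_conjTranspose]
  exact_mod_cast h

theorem minkInner_actMink (A : SL2C) (x y : Mink) :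
    minkInner (actMink A x) (actMink A y) = minkInner x y := by
  have h := minkInner_actMink_self A (x + y)
  rw [actMink_add] at h
  simp only [minkInner_add_left, minkInner_add_right, minkInner_actMink_self] at h
  rw [minkInner_comm (actMink A y) (actMink A x), minkInner_comm y x] at h
  linarith

theorem actMink_nullVec (A : SL2C) (κ : Spinor) : actMink A (nullVec κ) = nullVec (A • κ : Spinor) := by
  rw [actMink, nullVec, nullVec, LinearEquiv.symm_apply_apply]
  refine congrArg hermEquiv (Subtype.ext ?_)
  ext i j
  simp only [actHerm, Matrix.star_eq_conjTranspose]
  rw [spinorSq_apply]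
  simp [Matrix.mul_apply, Spinor.coe_smul, Matrix.mulVec, dotProduct, Fin.sum_univ_two,
    spinorSq_apply]
  ring

/-! ## The action on flags -/

theorem actHerm_spinorSqDeriv (A : SL2C) (κ ν : Fin 2 → ℂ) :
    actHerm A (spinorSqDeriv κ ν) =
      spinorSqDeriv ((A : Matrix (Fin 2) (Fin 2) ℂ) *ᵥ κ) ((A : Matrix (Fin 2) (Fin 2) ℂ) *ᵥ ν) := by
  refine Subtype.ext ?_
  ext i j
  simp only [actHerm, Matrix.star_eq_conjTranspose]
  rw [spinorSqDeriv_apply]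
  simp [Matrix.mul_apply, Matrix.mulVec, dotProduct, Fin.sum_univ_two, spinorSqDeriv_apply]
  ring

/-- Moving κ along its own complex line changes κκ* only by a real multiple of itself. Hence the
oriented flag depends on the direction ν only modulo ℂκ and up to a positive factor. -/
theorem spinorSqDeriv_smul_add (κ ν : Fin 2 → ℂ) (r : ℝ) (μ : ℂ) :
    spinorSqDeriv κ ((r : ℂ) • ν + μ • κ) =
      r • spinorSqDeriv κ ν + (2 * μ.re) • spinorSq κ := by
  refine Subtype.ext ?_
  ext i j
  have hμ : ((2 * μ.re : ℝ) : ℂ) = μ + star μ := by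
    apply Complex.ext <;> simp [two_mul]
  have h1 : ((r • spinorSqDeriv κ ν + (2 * μ.re) • spinorSq κ : Herm).1) i j =
      r * (spinorSqDeriv κ ν).1 i j + ((2 * μ.re : ℝ) : ℂ) * (spinorSq κ).1 i j := by
    simp
  rw [h1, hμ, spinorSqDeriv_apply, spinorSqDeriv_apply, spinorSq_apply]
  simp
  ring

/-- The spinors `Z(A κ)` and `A (Z κ)` agree modulo `A κ` up to a positive factor. -/
theorem exists_spinorZ_mulVec (A : SL2C) {κ : Fin 2 → ℂ} (hκ : κ ≠ 0) :
    ∃ (r : ℝ) (μ : ℂ), 0 < r ∧ spinorZ ((A : Matrix (Fin 2) (Fin 2) ℂ) *ᵥ κ) =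
      (r : ℂ) • ((A : Matrix (Fin 2) (Fin 2) ℂ) *ᵥ spinorZ κ) +
        μ • ((A : Matrix (Fin 2) (Fin 2) ℂ) *ᵥ κ) := by
  have hnorm : ∀ ν : Fin 2 → ℂ, (nullVec ν 0 : ℂ) = ν 0 * star (ν 0) + ν 1 * star (ν 1) := by
    intro ν
    apply Complex.ext <;> simp [nullVec_eq, pow_two] <;> ring
  set κ' := (A : Matrix (Fin 2) (Fin 2) ℂ) *ᵥ κ with hκ'
  set ν' := (A : Matrix (Fin 2) (Fin 2) ℂ) *ᵥ spinorZ κ with hν'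
  have hκ'0 : κ' ≠ 0 := Spinor.ne_zero (A • (⟨κ, hκ⟩ : Spinor))
  have hN := nullVec_zero_pos hκ
  have hN' := nullVec_zero_pos hκ'0
  -- Since det A = 1, this is the determinant of the pair κ, Zκ, which equals -i|κ|².
  have hd : κ' 0 * ν' 1 - κ' 1 * ν' 0 = -Complex.I * nullVec κ 0 := by
    have hA := A.2
    rw [Matrix.det_fin_two] at hA
    rw [hnorm]
    simp only [hκ', hν', Matrix.mulVec, dotProduct, Fin.sum_univ_two, spinorZ,
      Matrix.cons_val_zero, Matrix.cons_val_one]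
    linear_combination (-Complex.I * (κ 0 * star (κ 0) + κ 1 * star (κ 1))) * hA
  have hNC : (nullVec κ 0 : ℂ) ≠ 0 := by exact_mod_cast hN.ne'
  -- Cramer's rule for Z(Aκ) in the basis A(Zκ), Aκ. The coefficient of A(Zκ) is the ratio of
  -- -i|Aκ|² to -i|κ|², which is why it is real and positive.
  refine ⟨nullVec κ' 0 / nullVec κ 0,
    (spinorZ κ' 0 * ν' 1 - spinorZ κ' 1 * ν' 0) / (-Complex.I * nullVec κ 0),
    div_pos hN' hN, ?_⟩
  have hI : -Complex.I * (nullVec κ 0 : ℂ) ≠ 0 := mul_ne_zero (neg_ne_zero.2 Complex.I_ne_zero) hNC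
  have hr : ((nullVec κ' 0 / nullVec κ 0 : ℝ) : ℂ) =
      (κ' 0 * spinorZ κ' 1 - κ' 1 * spinorZ κ' 0) / (-Complex.I * nullVec κ 0) := by
    push_cast
    rw [div_eq_div_iff hNC hI, hnorm κ']
    simp [spinorZ]
    ring
  rw [hr]
  ext i
  refine mul_left_cancel₀ hI ?_
  simp only [Pi.add_apply, Pi.smul_apply, smul_eq_mul, mul_add, div_mul_eq_mul_div]
  rw [mul_div_cancel₀ _ hI, mul_div_cancel₀ _ hI, ← hd]
  fin_cases i <;> simp <;> ring

theorem exists_flagVec_smul (A : SL2C) (κ : Spinor) :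
    ∃ r c : ℝ, 0 < r ∧ flagVec (A • κ : Spinor) =
      r • actMink A (flagVec κ) + c • nullVec (A • κ : Spinor) := by
  obtain ⟨r, μ, hr, h⟩ := exists_spinorZ_mulVec A (Spinor.ne_zero κ)
  refine ⟨r, 2 * μ.re, hr, ?_⟩
  rw [actMink, flagVec, flagVec, nullVec, LinearEquiv.symm_apply_apply, actHerm_spinorSqDeriv,
    Spinor.coe_smul, h, spinorSqDeriv_smul_add, map_add, map_smul, map_smul]

/-- The line vector is the flag vector projected along p onto the orthogonal complement of x. The
projection removes the multiple of the null vector by which the two flag vectors differ, and it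
commutes with isometries. -/
theorem exists_lineVec_smul (A : SL2C) (κ : Spinor) :
    ∃ r : ℝ, 0 < r ∧ ∀ x, minkInner x (nullVec κ) = 1 →
      lineVec (A • κ) (actMink A x) = r • actMink A (lineVec κ x) := by
  obtain ⟨r, c, hr, h⟩ := exists_flagVec_smul A κ
  refine ⟨r, hr, fun x hx => ?_⟩
  rw [← minkInner_actMink A, actMink_nullVec] at hx
  simp only [lineVec, h, minkInner_add_right, minkInner_smul_right, hx, minkInner_actMink,
    actMink_add, actMink_smul, actMink_nullVec]
  module

/-! ## The hyperboloid and the upper half space -/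

theorem sub_pos_of_mem_hyperboloid {x : Mink} (hx : x ∈ hyperboloid) : 0 < x 0 - x 3 := by
  obtain ⟨h1, h2⟩ := hx
  simp only [minkInner] at h1
  nlinarith [sq_nonneg (x 1), sq_nonneg (x 2)]

/-- For x on the hyperboloid, ⟨x, p⟩ is a positive definite Hermitian form in κ; completing the
square with ⟨x, x⟩ = 1 makes the positivity visible. -/
theorem mul_minkInner_nullVec {x : Mink} (hx : x ∈ hyperboloid) (κ : Fin 2 → ℂ) :
    (x 0 - x 3) * minkInner x (nullVec κ) =
      Complex.normSq (κ 1 * ⟨x 1, x 2⟩ - κ 0 * ((x 0 - x 3 : ℝ) : ℂ)) + Complex.normSq (κ 1) := by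
  have h := hx.1
  simp only [minkInner] at h
  simp [minkInner, nullVec_eq, Complex.normSq_apply]
  linear_combination ((κ 1).re ^ 2 + (κ 1).im ^ 2) * h

theorem minkInner_nullVec_pos {x : Mink} (hx : x ∈ hyperboloid) {κ : Fin 2 → ℂ} (hκ : κ ≠ 0) :
    0 < minkInner x (nullVec κ) := by
  have h0 := sub_pos_of_mem_hyperboloid hx
  refine (mul_pos_iff_of_pos_left h0).1 ?_
  rw [mul_minkInner_nullVec hx]
  rcases eq_or_ne (κ 1) 0 with h | h
  · have : κ 0 ≠ 0 := fun h' => hκ (by ext i; fin_cases i <;> simp [h, h'])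
    rw [h]
    simp only [zero_mul, zero_sub, Complex.normSq_neg, Complex.normSq_mul, Complex.normSq_ofReal,
      Complex.normSq_zero, add_zero]
    have := Complex.normSq_pos.2 this
    positivity
  · have := Complex.normSq_pos.2 h
    have := Complex.normSq_nonneg (κ 1 * ⟨x 1, x 2⟩ - κ 0 * ((x 0 - x 3 : ℝ) : ℂ))
    linarith

/-- The sheet is recognised by its positive products with null vectors of spinors, and A permutes
these vectors. Testing on (1, 0, 0, 1) and (1, 0, 0, -1) and adding gives a positive time component.
-/
theorem actMink_mem_hyperboloid (A : SL2C) {x : Mink} (hx : x ∈ hyperboloid) :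
    actMink A x ∈ hyperboloid := by
  refine ⟨(minkInner_actMink A x x).trans hx.1, ?_⟩
  have key : ∀ κ : Spinor, 0 < minkInner (actMink A x) (nullVec κ) := by
    intro κ
    have h := actMink_nullVec A (A⁻¹ • κ)
    rw [smul_inv_smul] at h
    rw [← h, minkInner_actMink]
    exact minkInner_nullVec_pos hx (Spinor.ne_zero _)
  have h1 := key ⟨![1, 0], fun h => one_ne_zero (congrFun h 0)⟩
  have h2 := key ⟨![0, 1], fun h => one_ne_zero (congrFun h 1)⟩
  simp [minkInner, nullVec_eq] at h1 h2
  linarith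

/-- The isometry from the hyperboloid to the upper half space. -/
noncomputable def toUpper (x : Mink) : R3 :=
  ![x 1 / (x 0 - x 3), x 2 / (x 0 - x 3), 1 / (x 0 - x 3)]

/-- The inverse of `toUpper`. -/
noncomputable def ofUpper (y : R3) : Mink :=
  ![(y 0 ^ 2 + y 1 ^ 2 + y 2 ^ 2 + 1) / (2 * y 2), y 0 / y 2, y 1 / y 2,
    (y 0 ^ 2 + y 1 ^ 2 + y 2 ^ 2 - 1) / (2 * y 2)]

theorem jMap_iMap {x : Mink} (hx : x ∈ hyperboloid) : jMap (iMap x) = toUpper x := by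
  have h1 : 1 + x 0 ≠ 0 := by have := hx.2; positivity
  have h2 := (sub_pos_of_mem_hyperboloid hx).ne'
  have h := hx.1
  simp only [minkInner] at h
  have hD : (x 1 / (1 + x 0)) ^ 2 + (x 2 / (1 + x 0)) ^ 2 + (1 - x 3 / (1 + x 0)) ^ 2 =
      2 * (x 0 - x 3) / (1 + x 0) := by
    field_simp
    linear_combination -h
  have hS : 1 - iMap x ⬝ᵥ iMap x = 2 / (1 + x 0) := by
    simp [iMap, dotProduct, Fin.sum_univ_three]
    field_simp
    linear_combination h
  ext i
  fin_cases i <;> simp [jMap, hS, toUpper] <;> simp [iMap, hD] <;> field_simp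

theorem toUpper_mem {x : Mink} (hx : x ∈ hyperboloid) : toUpper x ∈ upperHalf :=
  one_div_pos.2 (sub_pos_of_mem_hyperboloid hx)

theorem ofUpper_mem {y : R3} (hy : y ∈ upperHalf) : ofUpper y ∈ hyperboloid := by
  have h : 0 < y 2 := hy
  refine ⟨?_, ?_⟩
  · simp [minkInner, ofUpper]
    field_simp
    ring
  · simp [ofUpper]
    positivity

theorem toUpper_ofUpper {y : R3} (hy : y ∈ upperHalf) : toUpper (ofUpper y) = y := by
  have h : y 2 ≠ 0 := ne_of_gt hy
  have hD : ofUpper y 0 - ofUpper y 3 = 1 / y 2 := by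
    simp [ofUpper]
    field_simp
    ring
  ext i
  fin_cases i <;> simp [toUpper, hD] <;> simp [ofUpper] <;> field_simp

theorem ofUpper_toUpper {x : Mink} (hx : x ∈ hyperboloid) : ofUpper (toUpper x) = x := by
  have h2 := (sub_pos_of_mem_hyperboloid hx).ne'
  have h := hx.1
  simp only [minkInner] at h
  ext i
  fin_cases i <;> simp [toUpper, ofUpper] <;> field_simp
  · linear_combination -h
  · linear_combination -h

theorem iInv_jInv {y : R3} (hy : y ∈ upperHalf) : iInv (jInv y) = ofUpper y := by
  have h : 0 < y 2 := hy
  have hD : y 0 ^ 2 + y 1 ^ 2 + (y 2 + 1) ^ 2 ≠ 0 := by positivity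
  have hS : jInv y ⬝ᵥ jInv y = 1 - 4 * y 2 / (y 0 ^ 2 + y 1 ^ 2 + (y 2 + 1) ^ 2) := by
    simp [jInv, dotProduct, Fin.sum_univ_three]
    field_simp
    ring
  ext i
  fin_cases i <;> simp [iInv, hS, ofUpper]
  · field_simp
    ring
  · simp [jInv]
    field_simp
    ring
  · simp [jInv]
    field_simp
    ring
  · simp [jInv, dotProduct, Fin.sum_univ_three]
    field_simp
    ring

theorem actUpper_eq (A : SL2C) {y : R3} (hy : y ∈ upperHalf) :
    actUpper A y = toUpper (actMink A (ofUpper y)) := by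
  rw [actUpper, actDisc, iInv_jInv hy, jMap_iMap (actMink_mem_hyperboloid A (ofUpper_mem hy))]

theorem actUpper_mem (A : SL2C) {y : R3} (hy : y ∈ upperHalf) : actUpper A y ∈ upperHalf := by
  rw [actUpper_eq A hy]
  exact toUpper_mem (actMink_mem_hyperboloid A (ofUpper_mem hy))

theorem actUpper_mul (A B : SL2C) {y : R3} (hy : y ∈ upperHalf) :
    actUpper (A * B) y = actUpper A (actUpper B y) := by
  rw [actUpper_eq A (actUpper_mem B hy), actUpper_eq B hy,
    ofUpper_toUpper (actMink_mem_hyperboloid B (ofUpper_mem hy)), ← actMink_mul, actUpper_eq _ hy]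

theorem actUpper_one {y : R3} (hy : y ∈ upperHalf) : actUpper 1 y = y := by
  rw [actUpper_eq 1 hy, actMink_one, toUpper_ofUpper hy]

theorem isOpen_upperHalf : IsOpen upperHalf :=
  isOpen_lt continuous_const (continuous_apply 2)

theorem differentiableAt_toUpper {x : Mink} (hx : x ∈ hyperboloid) :
    DifferentiableAt ℝ toUpper x := by
  have h := (sub_pos_of_mem_hyperboloid hx).ne'
  refine differentiableAt_pi.2 fun i => ?_
  fin_cases i <;> simp [toUpper] <;> fun_prop (disch := assumption)

theorem differentiableAt_ofUpper {y : R3} (hy : y ∈ upperHalf) :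
    DifferentiableAt ℝ ofUpper y := by
  have h : y 2 ≠ 0 := ne_of_gt hy
  have h' : 2 * y 2 ≠ 0 := mul_ne_zero two_ne_zero h
  refine differentiableAt_pi.2 fun i => ?_
  fin_cases i <;> simp [ofUpper] <;> fun_prop (disch := assumption)

theorem differentiableAt_iMap {x : Mink} (hx : x ∈ hyperboloid) : DifferentiableAt ℝ iMap x := by
  have h1 : 1 + x 0 ≠ 0 := by have := hx.2; positivity
  refine differentiableAt_pi.2 fun i => ?_
  fin_cases i <;> simp [iMap] <;> fun_prop (disch := assumption)

theorem iMap_mem_disc {x : Mink} (hx : x ∈ hyperboloid) : iMap x ∈ disc := by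
  have h1 : 0 < 1 + x 0 := by have := hx.2; positivity
  have h := hx.1
  simp only [minkInner] at h
  have hS : iMap x ⬝ᵥ iMap x = 1 - 2 / (1 + x 0) := by
    simp [iMap, dotProduct, Fin.sum_univ_three]
    field_simp
    linear_combination -h
  change iMap x ⬝ᵥ iMap x < 1
  rw [hS]
  have : 0 < 2 / (1 + x 0) := by positivity
  linarith

theorem differentiableAt_jMap {y : R3} (hy : y ∈ disc) : DifferentiableAt ℝ jMap y := by
  have h : y ⬝ᵥ y < 1 := hy
  simp only [dotProduct, Fin.sum_univ_three] at h
  have h1 : y 0 ^ 2 + y 1 ^ 2 + (1 - y 2) ^ 2 ≠ 0 := by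
    have : 0 < (1 - y 2) ^ 2 := by
      have : y 2 < 1 := by nlinarith [sq_nonneg (y 0), sq_nonneg (y 1)]
      have : 0 < 1 - y 2 := by linarith
      positivity
    positivity
  refine differentiableAt_pi.2 fun i => ?_
  fin_cases i <;> simp [jMap, dotProduct, Fin.sum_univ_three] <;> fun_prop (disch := assumption)

theorem differentiableAt_actUpper (A : SL2C) {y : R3} (hy : y ∈ upperHalf) :
    DifferentiableAt ℝ (actUpper A) y := by
  have h : DifferentiableAt ℝ (toUpper ∘ actMink A ∘ ofUpper) y :=
    (differentiableAt_toUpper (actMink_mem_hyperboloid A (ofUpper_mem hy))).comp y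
      ((differentiableAt_actMink A _).comp y (differentiableAt_ofUpper hy))
  refine h.congr_of_eventuallyEq ?_
  filter_upwards [isOpen_upperHalf.mem_nhds hy] with z hz using actUpper_eq A hz

/-! ## The decorated horosphere of a spinor and its equivariance -/

theorem hyperboloidHorosphere_map_actMink (A : SL2C) (κ : Spinor) :
    (hyperboloidHorosphere κ).map (actMink A) = hyperboloidHorosphere (A • κ) := by
  have hinj : Function.Injective (actMink A) := by
    intro x y h
    simpa [← actMink_mul, actMink_one] using congrArg (actMink A⁻¹) h
  have hcarrier : ∀ x, actMink A x ∈ (hyperboloidHorosphere (A • κ)).carrier ↔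
      x ∈ (hyperboloidHorosphere κ).carrier := by
    intro x
    simp only [mem_hyperboloidHorosphere_carrier, ← actMink_nullVec, minkInner_actMink]
    refine and_congr_left fun _ => ⟨fun h => ?_, actMink_mem_hyperboloid A⟩
    simpa [← actMink_mul, actMink_one] using actMink_mem_hyperboloid A⁻¹ h
  have hsurj : ∀ y, ∃ x, actMink A x = y := fun y =>
    ⟨actMink A⁻¹ y, by simp [← actMink_mul, actMink_one]⟩
  ext y w
  · obtain ⟨x, rfl⟩ := hsurj y
    rw [hcarrier]
    exact hinj.mem_set_image
  · obtain ⟨x, rfl⟩ := hsurj y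
    by_cases hx : x ∈ (hyperboloidHorosphere κ).carrier
    · rw [OverlyDecorated.map_dir_of_injOn hinj.injOn hx, hyperboloidHorosphere_dir hx,
        hyperboloidHorosphere_dir ((hcarrier x).2 hx), fderiv_actMink]
      obtain ⟨r, hr, h⟩ := exists_lineVec_smul A κ
      rw [h x hx.2]
      constructor
      · rintro ⟨_, ⟨c, hc, rfl⟩, rfl⟩
        refine ⟨c / r, div_pos hc hr, ?_⟩
        rw [coe_actMinkCLM, actMink_smul, smul_smul, div_mul_cancel₀ _ hr.ne']
      · rintro ⟨c, hc, rfl⟩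
        exact ⟨(c * r) • lineVec κ x, ⟨c * r, mul_pos hc hr, rfl⟩, by
          rw [coe_actMinkCLM, actMink_smul, smul_smul]⟩
    · rw [hyperboloidHorosphere_dir_of_notMem (mt (hcarrier x).1 hx)]
      constructor
      · rintro ⟨q, hq, he, -⟩
        exact hx (hinj he ▸ hq)
      · exact fun h => h.elim

/-- The decorated horosphere of a spinor in the upper half space. -/
noncomputable def spinorHorosphere (κ : Spinor) : OverlyDecorated R3 :=
  mapJ (mapI (mapH (mapG (mapF κ))))

theorem spinorHorosphere_eq (κ : Spinor) :
    spinorHorosphere κ = (hyperboloidHorosphere κ).map toUpper := by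
  have hj : ∀ q ∈ (hyperboloidHorosphere κ).carrier, DifferentiableAt ℝ jMap (iMap q) :=
    fun q hq => differentiableAt_jMap (iMap_mem_disc hq.1)
  have hi : ∀ q ∈ (hyperboloidHorosphere κ).carrier, DifferentiableAt ℝ iMap q :=
    fun q hq => differentiableAt_iMap hq.1
  have h1 : spinorHorosphere κ = (hyperboloidHorosphere κ).map (jMap ∘ iMap) :=
    OverlyDecorated.map_map _ hi hj
  rw [h1]
  exact OverlyDecorated.map_congr (hyperboloidHorosphere_isTangent κ)
    (fun q hq => (hj q hq).comp q (hi q hq)) (fun q hq => differentiableAt_toUpper hq.1)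
    fun q hq => jMap_iMap hq.1

theorem spinorHorosphere_map_actUpper (A : SL2C) (κ : Spinor) :
    (spinorHorosphere κ).map (actUpper A) = spinorHorosphere (A • κ) := by
  have h1 : ∀ q ∈ (hyperboloidHorosphere κ).carrier, DifferentiableAt ℝ toUpper q :=
    fun q hq => differentiableAt_toUpper hq.1
  have h2 : ∀ q ∈ (hyperboloidHorosphere κ).carrier, DifferentiableAt ℝ (actUpper A) (toUpper q) :=
    fun q hq => differentiableAt_actUpper A (toUpper_mem hq.1)
  have h3 : ∀ q ∈ (hyperboloidHorosphere κ).carrier, DifferentiableAt ℝ (actMink A) q :=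
    fun q _ => differentiableAt_actMink A q
  have h4 : ∀ q ∈ (hyperboloidHorosphere κ).carrier, DifferentiableAt ℝ toUpper (actMink A q) :=
    fun q hq => differentiableAt_toUpper (actMink_mem_hyperboloid A hq.1)
  rw [spinorHorosphere_eq, spinorHorosphere_eq, ← hyperboloidHorosphere_map_actMink,
    OverlyDecorated.map_map _ h1 h2, OverlyDecorated.map_map _ h3 h4]
  refine OverlyDecorated.map_congr (hyperboloidHorosphere_isTangent κ)
    (fun q hq => (h2 q hq).comp q (h1 q hq)) (fun q hq => (h4 q hq).comp q (h3 q hq)) ?_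
  intro q hq
  simp only [Function.comp_apply]
  rw [actUpper_eq A (toUpper_mem hq.1), ofUpper_toUpper hq.1]

/-- The equation ⟨x, p⟩ = 1 in upper half space coordinates, cleared of denominators. For η = 0 it
is the plane at height |ξ|², otherwise the sphere tangent to the boundary at ξ/η with diameter
1/|η|². -/
theorem mem_spinorHorosphere_carrier {κ : Spinor} {y : R3} :
    y ∈ (spinorHorosphere κ).carrier ↔ y ∈ upperHalf ∧
      Complex.normSq ((κ : Fin 2 → ℂ) 1 * ⟨y 0, y 1⟩ - (κ : Fin 2 → ℂ) 0) +
        Complex.normSq ((κ : Fin 2 → ℂ) 1) * y 2 ^ 2 = y 2 := by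
  have key : ∀ y ∈ upperHalf, ofUpper y ∈ (hyperboloidHorosphere κ).carrier ↔
      Complex.normSq ((κ : Fin 2 → ℂ) 1 * ⟨y 0, y 1⟩ - (κ : Fin 2 → ℂ) 0) +
        Complex.normSq ((κ : Fin 2 → ℂ) 1) * y 2 ^ 2 = y 2 := by
    intro y hy
    have h : 0 < y 2 := hy
    rw [mem_hyperboloidHorosphere_carrier, and_iff_right (ofUpper_mem hy)]
    have e : y 2 * minkInner (ofUpper y) (nullVec κ) =
        Complex.normSq ((κ : Fin 2 → ℂ) 1 * ⟨y 0, y 1⟩ - (κ : Fin 2 → ℂ) 0) +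
        Complex.normSq ((κ : Fin 2 → ℂ) 1) * y 2 ^ 2 := by
      simp [minkInner, ofUpper, nullVec_eq, Complex.normSq_apply]
      field_simp
      ring
    rw [← e]
    constructor
    · intro h1
      rw [h1, mul_one]
    · intro h1
      exact mul_left_cancel₀ h.ne' (h1.trans (mul_one _).symm)
  rw [spinorHorosphere_eq]
  constructor
  · rintro ⟨x, hx, rfl⟩
    have hU := toUpper_mem hx.1
    refine ⟨hU, (key _ hU).1 ?_⟩
    rwa [ofUpper_toUpper hx.1]
  · rintro ⟨hy, h⟩
    exact ⟨ofUpper y, (key y hy).2 h, toUpper_ofUpper hy⟩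

/-! ## Decorated horospheres -/

/-- A horosphere with a parallel oriented tangent line field. -/
def IsDecorated (S : OverlyDecorated R3) : Prop :=
  IsHorosphere S.carrier ∧ S.IsOrientedLineField ∧ S.IsParallel

theorem IsHorosphere.subset_upperHalf {s : Set R3} (hs : IsHorosphere s) : s ⊆ upperHalf := by
  rcases hs with ⟨c, hc, rfl⟩ | ⟨a, b, r, -, rfl⟩
  · intro y hy
    exact hc.trans_eq (Eq.symm hy)
  · exact fun y hy => hy.1

theorem isHorosphere_spinorHorosphere (κ : Spinor) : IsHorosphere (spinorHorosphere κ).carrier := by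
  by_cases h : (κ : Fin 2 → ℂ) 1 = 0
  · have h0 : (κ : Fin 2 → ℂ) 0 ≠ 0 := fun h0 =>
      Spinor.ne_zero κ (by ext i; fin_cases i <;> simp [h, h0])
    refine Or.inl ⟨Complex.normSq ((κ : Fin 2 → ℂ) 0), Complex.normSq_pos.2 h0, ?_⟩
    ext y
    rw [mem_spinorHorosphere_carrier, h]
    simp only [zero_mul, zero_sub, Complex.normSq_neg, map_zero, add_zero]
    exact ⟨fun hy => hy.2.symm, fun hy => ⟨(Complex.normSq_pos.2 h0).trans_eq (Eq.symm hy), Eq.symm hy⟩⟩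
  · have hN := Complex.normSq_pos.2 h
    set N := Complex.normSq ((κ : Fin 2 → ℂ) 1)
    set m := (κ : Fin 2 → ℂ) 0 / (κ : Fin 2 → ℂ) 1 with hm
    refine Or.inr ⟨m.re, m.im, 1 / (2 * N), by positivity, ?_⟩
    ext y
    rw [mem_spinorHorosphere_carrier]
    refine and_congr_right fun _ => ?_
    have e : Complex.normSq ((κ : Fin 2 → ℂ) 1 * ⟨y 0, y 1⟩ - (κ : Fin 2 → ℂ) 0) =
        N * ((y 0 - m.re) ^ 2 + (y 1 - m.im) ^ 2) := by
      have : (κ : Fin 2 → ℂ) 1 * ⟨y 0, y 1⟩ - (κ : Fin 2 → ℂ) 0 =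
          (κ : Fin 2 → ℂ) 1 * (⟨y 0, y 1⟩ - m) := by
        rw [mul_sub, hm, mul_div_cancel₀ _ h]
      rw [this, Complex.normSq_mul, Complex.normSq_apply (_ - m)]
      simp only [Complex.sub_re, Complex.sub_im, N]
      ring
    rw [e]
    field_simp
    constructor
    · intro h'
      linear_combination 4 * N * h'
    · intro h'
      refine mul_left_cancel₀ (mul_pos four_pos hN).ne' ?_
      linear_combination h'

theorem exists_spinorHorosphere_carrier_eq {s : Set R3} (hs : IsHorosphere s) :
    ∃ κ, (spinorHorosphere κ).carrier = s := by
  rcases hs with ⟨c, hc, rfl⟩ | ⟨a, b, r, hr, rfl⟩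
  · have hs : √c ≠ 0 := (Real.sqrt_pos.2 hc).ne'
    refine ⟨⟨![(√c : ℂ), 0], fun h => hs (by simpa using congrFun h 0)⟩, ?_⟩
    ext y
    rw [mem_spinorHorosphere_carrier]
    simp only [Matrix.cons_val_zero, Matrix.cons_val_one, zero_mul, zero_sub, Complex.normSq_neg,
      map_zero, add_zero, Complex.normSq_ofReal, Real.mul_self_sqrt hc.le]
    exact ⟨fun hy => hy.2.symm, fun hy => ⟨hc.trans_eq (Eq.symm hy), Eq.symm hy⟩⟩
  · have hn : 0 < 1 / (2 * r) := by positivity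
    have hs : √(1 / (2 * r)) ≠ 0 := (Real.sqrt_pos.2 hn).ne'
    have hss := Real.mul_self_sqrt hn.le
    set n := √(1 / (2 * r))
    refine ⟨⟨![n * ⟨a, b⟩, (n : ℂ)], fun h => hs (by simpa using congrFun h 1)⟩, ?_⟩
    ext y
    rw [mem_spinorHorosphere_carrier]
    refine and_congr_right fun _ => ?_
    simp only [Matrix.cons_val_zero, Matrix.cons_val_one, ← mul_sub, Complex.normSq_mul,
      Complex.normSq_ofReal, hss, Complex.normSq_apply (_ - _), Complex.sub_re, Complex.sub_im]
    field_simp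
    constructor <;> intro h' <;> linear_combination h'

theorem image_actUpper_mul (A B : SL2C) {s : Set R3} (hs : s ⊆ upperHalf) :
    actUpper (A * B) '' s = actUpper A '' (actUpper B '' s) := by
  rw [Set.image_image]
  exact Set.image_congr fun y hy => actUpper_mul A B (hs hy)

theorem image_actUpper_one {s : Set R3} (hs : s ⊆ upperHalf) : actUpper 1 '' s = s :=
  (Set.image_congr fun _ hy => actUpper_one (hs hy)).trans (Set.image_id s)

theorem map_actUpper_map {S : OverlyDecorated R3} (hU : S.carrier ⊆ upperHalf) (hS : S.IsTangent)
    (A B : SL2C) : (S.map (actUpper B)).map (actUpper A) = S.map (actUpper (A * B)) := by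
  have h1 : ∀ q ∈ S.carrier, DifferentiableAt ℝ (actUpper B) q :=
    fun q hq => differentiableAt_actUpper B (hU hq)
  have h2 : ∀ q ∈ S.carrier, DifferentiableAt ℝ (actUpper A) (actUpper B q) :=
    fun q hq => differentiableAt_actUpper A (actUpper_mem B (hU hq))
  rw [OverlyDecorated.map_map _ h1 h2]
  exact OverlyDecorated.map_congr hS (fun q hq => (h2 q hq).comp q (h1 q hq))
    (fun _ hq => differentiableAt_actUpper _ (hU hq))
    fun _ hq => (actUpper_mul A B (hU hq)).symm

theorem IsDecorated.map_mul {S : OverlyDecorated R3} (hS : IsDecorated S) (A B : SL2C) :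
    S.map (actUpper (A * B)) = (S.map (actUpper B)).map (actUpper A) :=
  (map_actUpper_map hS.1.subset_upperHalf hS.2.1.isTangent A B).symm

theorem IsDecorated.map_one {S : OverlyDecorated R3} (hS : IsDecorated S) :
    S.map (actUpper 1) = S :=
  OverlyDecorated.map_eq_self hS.2.1.isTangent hS.2.1.2
    (fun _ hq => differentiableAt_actUpper 1 (hS.1.subset_upperHalf hq))
    fun _ hq => actUpper_one (hS.1.subset_upperHalf hq)

/-- The image of the carrier is a horosphere because the carrier, without its decoration, comes from
a spinor. Parallelism transfers by conjugation: if B preserves the image then A⁻¹BA preserves the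
original and has the same trace. -/
theorem IsDecorated.map {S : OverlyDecorated R3} (hS : IsDecorated S) (A : SL2C) :
    IsDecorated (S.map (actUpper A)) := by
  have hU := hS.1.subset_upperHalf
  refine ⟨?_, ?_, ?_⟩
  · obtain ⟨κ, hκ⟩ := exists_spinorHorosphere_carrier_eq hS.1
    have h := congrArg OverlyDecorated.carrier (spinorHorosphere_map_actUpper A κ)
    change IsHorosphere (actUpper A '' S.carrier)
    rw [← hκ]
    change actUpper A '' (spinorHorosphere κ).carrier = _ at h
    rw [h]
    exact isHorosphere_spinorHorosphere _
  · refine hS.2.1.map (ψ := actUpper A⁻¹) (fun q hq => differentiableAt_actUpper A (hU hq))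
      (fun q hq => differentiableAt_actUpper _ (actUpper_mem A (hU hq))) fun q hq => ?_
    rw [← actUpper_mul _ _ (hU hq), inv_mul_cancel, actUpper_one (hU hq)]
  · intro B hB hBS
    change actUpper B '' (actUpper A '' S.carrier) = actUpper A '' S.carrier at hBS
    have htr : ((A⁻¹ * (B * A) : SL2C) : Matrix (Fin 2) (Fin 2) ℂ).trace =
        (B : Matrix (Fin 2) (Fin 2) ℂ).trace := by
      rw [Matrix.SpecialLinearGroup.coe_mul, Matrix.trace_mul_comm,
        ← Matrix.SpecialLinearGroup.coe_mul, mul_inv_cancel_right]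
    have h := hS.2.2 (A⁻¹ * (B * A)) (by rwa [htr]) (by
      rw [image_actUpper_mul _ _ hU, image_actUpper_mul _ _ hU, hBS, ← image_actUpper_mul _ _ hU,
        inv_mul_cancel, image_actUpper_one hU])
    rw [← hS.map_mul]
    conv_rhs => rw [← h, ← hS.map_mul, mul_inv_cancel_left]

/-! ## Horospheres centred at infinity -/

/-- Avoids Jacobians: the model maps are fractions, and in the directions that matter the
denominator is constant, so they are affine along the line. -/
theorem fderiv_apply_eq_of_line {E E' : Type*} [NormedAddCommGroup E] [NormedSpace ℝ E]
    [NormedAddCommGroup E'] [NormedSpace ℝ E'] {φ : E → E'} {q w : E} {v : E'}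
    (hφ : DifferentiableAt ℝ φ q) (h : ∀ᶠ s : ℝ in 𝓝 0, φ (q + s • w) = φ q + s • v) :
    fderiv ℝ φ q w = v := by
  have hφ' : HasFDerivAt φ (fderiv ℝ φ q) (q + (0 : ℝ) • w) := by
    simpa using hφ.hasFDerivAt
  have hl' : HasDerivAt (fun s : ℝ => φ q + s • v) v 0 := by
    simpa using ((hasDerivAt_id (0 : ℝ)).smul_const v).const_add (φ q)
  have hl'' : HasDerivAt (fun s : ℝ => q + s • w) w 0 := by
    simpa using ((hasDerivAt_id (0 : ℝ)).smul_const w).const_add q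
  exact (hφ'.comp_hasDerivAt 0 hl'').unique (hl'.congr_of_eventuallyEq h)

theorem fderiv_toUpper {x w : Mink} (hx : x ∈ hyperboloid) (hw : w 0 = w 3) :
    fderiv ℝ toUpper x w = (x 0 - x 3)⁻¹ • ![w 1, w 2, 0] := by
  refine fderiv_apply_eq_of_line (differentiableAt_toUpper hx) (Filter.Eventually.of_forall ?_)
  intro s
  ext i
  fin_cases i <;> simp [toUpper, hw] <;> ring

/-- The decorated horosphere of a spinor `(ξ, 0)` with `|ξ| = 1`: the plane `z = 1`, decorated by
the direction of `i ξ²`. -/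
theorem spinorHorosphere_dir_of_eq_zero {κ : Spinor} (h1 : (κ : Fin 2 → ℂ) 1 = 0)
    {y : R3} (hy : y ∈ (spinorHorosphere κ).carrier) (hy2 : y 2 = 1) :
    (spinorHorosphere κ).dir y = {w | ∃ c : ℝ, 0 < c ∧ w =
      c • ![-((κ : Fin 2 → ℂ) 0 ^ 2).im, ((κ : Fin 2 → ℂ) 0 ^ 2).re, 0]} := by
  have hinj : Set.InjOn toUpper (hyperboloidHorosphere κ).carrier :=
    Set.LeftInvOn.injOn (f₁' := ofUpper) fun x hx => ofUpper_toUpper hx.1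
  rw [spinorHorosphere_eq] at hy ⊢
  obtain ⟨x, hx, rfl⟩ := hy
  rw [OverlyDecorated.map_dir_of_injOn hinj hx, hyperboloidHorosphere_dir hx]
  have hd : x 0 - x 3 = 1 := by
    have : 1 / (x 0 - x 3) = 1 := hy2
    rwa [one_div, inv_eq_one] at this
  have h : fderiv ℝ toUpper x (lineVec κ x) =
      (2 : ℝ) • ![-((κ : Fin 2 → ℂ) 0 ^ 2).im, ((κ : Fin 2 → ℂ) 0 ^ 2).re, 0] := by
    rw [fderiv_toUpper hx.1 (by simp [lineVec, flagVec_eq, nullVec_eq, h1]), hd]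
    ext i
    fin_cases i <;> simp [lineVec, flagVec_eq, nullVec_eq, h1, pow_two]
    ring
  ext w
  constructor
  · rintro ⟨_, ⟨c, hc, rfl⟩, rfl⟩
    exact ⟨c * 2, by positivity, by rw [map_smul, h, smul_smul]⟩
  · rintro ⟨c, hc, rfl⟩
    refine ⟨_, ⟨c / 2, by positivity, rfl⟩, ?_⟩
    rw [map_smul, h, smul_smul, div_mul_cancel₀ _ two_ne_zero]

theorem spinorHorosphere_carrier_eq_plane {κ : Spinor} :
    (spinorHorosphere κ).carrier = {y | y 2 = 1} ↔
      (κ : Fin 2 → ℂ) 1 = 0 ∧ Complex.normSq ((κ : Fin 2 → ℂ) 0) = 1 := by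
  constructor
  · intro h
    have key : ∀ z : ℂ, Complex.normSq ((κ : Fin 2 → ℂ) 1 * z - (κ : Fin 2 → ℂ) 0) +
        Complex.normSq ((κ : Fin 2 → ℂ) 1) = 1 := by
      intro z
      have hz : ![z.re, z.im, 1] ∈ (spinorHorosphere κ).carrier := by
        rw [h]
        rfl
      simpa using (mem_spinorHorosphere_carrier.1 hz).2
    have h1 : (κ : Fin 2 → ℂ) 1 = 0 := by
      by_contra h1
      -- At this z one has ηz - ξ = 2, and 4 + |η|² cannot be 1. The horosphere would have to be
      -- bounded, unlike the plane.
      have h2 := key (((κ : Fin 2 → ℂ) 0 + 2) / (κ : Fin 2 → ℂ) 1)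
      rw [mul_div_cancel₀ _ h1, add_sub_cancel_left] at h2
      have := Complex.normSq_nonneg ((κ : Fin 2 → ℂ) 1)
      norm_num [Complex.normSq_apply (2 : ℂ)] at h2
      linarith
    exact ⟨h1, by simpa [h1] using key 0⟩
  · rintro ⟨h1, h0⟩
    ext y
    rw [mem_spinorHorosphere_carrier, h1]
    simp only [zero_mul, zero_sub, Complex.normSq_neg, map_zero, add_zero, h0]
    exact ⟨fun hy => hy.2.symm, fun hy => ⟨one_pos.trans_eq (Eq.symm hy), Eq.symm hy⟩⟩

theorem spinorHorosphere_neg (κ : Spinor) :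
    spinorHorosphere ((-1 : ℤˣ) • κ) = spinorHorosphere κ := by
  have h1 : spinorSq ((-1 : ℤˣ) • κ : Spinor) = spinorSq κ := by
    refine Subtype.ext ?_
    ext i j
    rw [spinorSq_apply, spinorSq_apply, Spinor.coe_neg_one_smul]
    simp
  have h2 : spinorSqDeriv ((-1 : ℤˣ) • κ : Spinor) (spinorZ ((-1 : ℤˣ) • κ : Spinor)) =
      spinorSqDeriv κ (spinorZ κ) := by
    refine Subtype.ext ?_
    ext i j
    rw [spinorSqDeriv_apply, spinorSqDeriv_apply, Spinor.coe_neg_one_smul]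
    fin_cases i <;> fin_cases j <;> simp [spinorZ]
  have h : mapF ((-1 : ℤˣ) • κ) = mapF κ := by
    simp only [mapF, NullFlag.of, h1, h2]
  simp only [spinorHorosphere, h]

/-- The spinor `(1, 0)`. -/
def baseSpinor : Spinor := ⟨![1, 0], fun h => one_ne_zero (congrFun h 0)⟩

theorem exists_smul_baseSpinor (κ : Spinor) : ∃ A : SL2C, A • baseSpinor = κ := by
  by_cases h : (κ : Fin 2 → ℂ) 0 = 0
  · have h1 : (κ : Fin 2 → ℂ) 1 ≠ 0 := fun h1 =>
      Spinor.ne_zero κ (by ext i; fin_cases i <;> simp [h, h1])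
    refine ⟨⟨!![0, -((κ : Fin 2 → ℂ) 1)⁻¹; (κ : Fin 2 → ℂ) 1, 0], ?_⟩, Subtype.ext ?_⟩
    · simp [Matrix.det_fin_two, h1]
    · refine (Spinor.coe_smul _ _).trans ?_
      ext i
      fin_cases i <;> simp [baseSpinor, h]
  · refine ⟨⟨!![(κ : Fin 2 → ℂ) 0, 0; (κ : Fin 2 → ℂ) 1, ((κ : Fin 2 → ℂ) 0)⁻¹], ?_⟩,
      Subtype.ext ?_⟩
    · simp [Matrix.det_fin_two, h]
    · refine (Spinor.coe_smul _ _).trans ?_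
      ext i
      fin_cases i <;> simp [baseSpinor]

theorem spinorHorosphere_baseSpinor_carrier :
    (spinorHorosphere baseSpinor).carrier = {y | y 2 = 1} :=
  spinorHorosphere_carrier_eq_plane.2 (by simp [baseSpinor])

theorem spinorHorosphere_dir_of_notMem {κ : Spinor} {y : R3}
    (hy : y ∉ (spinorHorosphere κ).carrier) : (spinorHorosphere κ).dir y = ∅ := by
  rw [spinorHorosphere_eq] at hy ⊢
  refine Set.eq_empty_iff_forall_notMem.2 ?_
  rintro _ ⟨q, hq, rfl, -⟩
  exact hy ⟨q, hq, rfl⟩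

/-- A parabolic matrix preserving the plane z = 1 fixes (1, 0) up to sign, and equivariance with
sign invariance then fixes the decoration. -/
theorem isDecorated_baseSpinor : IsDecorated (spinorHorosphere baseSpinor) := by
  refine ⟨isHorosphere_spinorHorosphere _, ⟨?_, fun q => spinorHorosphere_dir_of_notMem⟩, ?_⟩
  · intro y hy
    have hy2 : y 2 = 1 := by rwa [spinorHorosphere_baseSpinor_carrier] at hy
    rw [spinorHorosphere_dir_of_eq_zero rfl hy hy2]
    refine ⟨_, ⟨fun s => y + s • ![-((baseSpinor : Fin 2 → ℂ) 0 ^ 2).im,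
      ((baseSpinor : Fin 2 → ℂ) 0 ^ 2).re, 0], by simp, ?_, ?_⟩, ?_, rfl⟩
    · refine Filter.Eventually.of_forall fun s => ?_
      rw [spinorHorosphere_baseSpinor_carrier]
      change y 2 + s * 0 = 1
      rw [mul_zero, add_zero, hy2]
    · have h := ((hasDerivAt_id (0 : ℝ)).smul_const ![-((baseSpinor : Fin 2 → ℂ) 0 ^ 2).im,
        ((baseSpinor : Fin 2 → ℂ) 0 ^ 2).re, (0 : ℝ)]).const_add y
      rwa [one_smul] at h
    · intro h
      simpa [baseSpinor] using congrFun h 1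
  · intro A hA hAS
    rw [spinorHorosphere_map_actUpper]
    have h := congrArg OverlyDecorated.carrier (spinorHorosphere_map_actUpper A baseSpinor)
    change actUpper A '' (spinorHorosphere baseSpinor).carrier = _ at h
    rw [hAS, spinorHorosphere_baseSpinor_carrier] at h
    obtain ⟨h1, -⟩ := spinorHorosphere_carrier_eq_plane.1 h.symm
    have hdet := A.2
    rw [Matrix.det_fin_two] at hdet
    rw [Spinor.coe_smul] at h1
    simp [baseSpinor, Matrix.mulVec, dotProduct, Fin.sum_univ_two] at h1
    rw [h1, mul_zero, sub_zero] at hdet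
    -- The matrix is upper triangular with determinant 1 and trace ±2, so its diagonal entries are a
    -- double root of the characteristic polynomial.
    have hcases : A.1 0 0 = 1 ∨ A.1 0 0 = -1 := by
      rw [Matrix.trace_fin_two] at hA
      rcases hA with hA | hA
      · left
        have : (A.1 0 0 - 1) ^ 2 = 0 := by linear_combination A.1 0 0 * hA - hdet
        exact sub_eq_zero.1 (pow_eq_zero_iff two_ne_zero |>.1 this)
      · right
        have : (A.1 0 0 + 1) ^ 2 = 0 := by linear_combination A.1 0 0 * hA - hdet
        exact eq_neg_of_add_eq_zero_left (pow_eq_zero_iff two_ne_zero |>.1 this)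
    rcases hcases with h0 | h0
    · refine congrArg spinorHorosphere (Subtype.ext ?_)
      rw [Spinor.coe_smul]
      ext i
      fin_cases i <;> simp [baseSpinor, h0, h1]
    · refine Eq.trans (congrArg spinorHorosphere (Subtype.ext ?_)) (spinorHorosphere_neg _)
      rw [Spinor.coe_smul, Spinor.coe_neg_one_smul]
      ext i
      fin_cases i <;> simp [baseSpinor, h0, h1]

theorem isDecorated_spinorHorosphere (κ : Spinor) : IsDecorated (spinorHorosphere κ) := by
  obtain ⟨A, rfl⟩ := exists_smul_baseSpinor κ
  rw [← spinorHorosphere_map_actUpper]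
  exact isDecorated_baseSpinor.map A

/-! ### Parallel fields on the plane z = 1 and classification of decorated horospheres -/

/-- The matrix `((1, b), (0, 1))`. -/
def shear (b : ℂ) : SL2C := ⟨!![1, b; 0, 1], by simp⟩

theorem actMink_shear (b : ℂ) (p : Mink) : actMink (shear b) p =
    ![p 0 + (b.re * p 1 + b.im * p 2 + (b.re ^ 2 + b.im ^ 2) * (p 0 - p 3) / 2),
      p 1 + b.re * (p 0 - p 3), p 2 + b.im * (p 0 - p 3),
      p 3 + (b.re * p 1 + b.im * p 2 + (b.re ^ 2 + b.im ^ 2) * (p 0 - p 3) / 2)] := by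
  have hs : star !![1, b; 0, 1] = !![1, 0; star b, 1] := by
    ext i j
    fin_cases i <;> fin_cases j <;> simp [Matrix.star_apply]
  have hA : ((shear b : SL2C) : Matrix (Fin 2) (Fin 2) ℂ) = !![1, b; 0, 1] := rfl
  ext i
  fin_cases i <;>
    simp [actMink, actHerm, hA, hs, hermEquiv, herm] <;> ring

theorem actUpper_shear (b : ℂ) {y : R3} (hy : y ∈ upperHalf) :
    actUpper (shear b) y = y + ![b.re, b.im, 0] := by
  rw [actUpper_eq _ hy]
  conv_rhs => rw [← toUpper_ofUpper hy]
  have h := (sub_pos_of_mem_hyperboloid (ofUpper_mem hy)).ne'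
  generalize ofUpper y = p at h
  ext i
  fin_cases i <;> simp [toUpper, actMink_shear] <;> field_simp

theorem fderiv_actUpper_shear (b : ℂ) {y : R3} (hy : y ∈ upperHalf) (w : R3) :
    fderiv ℝ (actUpper (shear b)) y w = w := by
  refine fderiv_apply_eq_of_line (differentiableAt_actUpper _ hy) ?_
  have hc : ContinuousAt (fun s : ℝ => y + s • w) 0 := by fun_prop
  have hU : ∀ᶠ s : ℝ in 𝓝 0, y + s • w ∈ upperHalf :=
    hc.eventually_mem (isOpen_upperHalf.mem_nhds (by simpa using hy))
  filter_upwards [hU] with s hs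
  rw [actUpper_shear b hs, actUpper_shear b hy, add_right_comm]

/-- A parallel line field on the plane `z = 1` is constant. -/
theorem IsDecorated.dir_eq_of_plane {S : OverlyDecorated R3} (hS : IsDecorated S)
    (hC : S.carrier = {y | y 2 = 1}) {y : R3} (hy : y 2 = 1) : S.dir y = S.dir ![0, 0, 1] := by
  have hU := hS.1.subset_upperHalf
  have hmem : ∀ {q : R3}, q 2 = 1 → q ∈ S.carrier := fun h => by rwa [hC]
  set b : ℂ := ⟨-y 0, -y 1⟩
  have hact : ∀ c : ℂ, ∀ q ∈ S.carrier, actUpper (shear c) q ∈ S.carrier := by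
    intro c q hq
    rw [actUpper_shear c (hU hq)]
    rw [hC] at hq ⊢
    exact (add_zero (q 2)).trans hq
  have himg : actUpper (shear b) '' S.carrier = S.carrier := by
    refine Set.Subset.antisymm (Set.image_subset_iff.2 (hact b)) fun q hq => ?_
    refine ⟨_, hact (-b) q hq, ?_⟩
    rw [actUpper_shear b (hU (hact (-b) q hq)), actUpper_shear (-b) (hU hq)]
    have : ![(-b).re, (-b).im, 0] = -![b.re, b.im, 0] := by
      ext i
      fin_cases i <;> simp
    rw [this, neg_add_cancel_right]
  have hmap := hS.2.2 (shear b) (Or.inl (by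
    rw [Matrix.trace_fin_two]
    norm_num [shear])) himg
  have hinj : Set.InjOn (actUpper (shear b)) S.carrier := by
    intro p hp q hq h
    rw [actUpper_shear b (hU hp), actUpper_shear b (hU hq)] at h
    exact add_right_cancel h
  have hpt : actUpper (shear b) y = ![0, 0, 1] := by
    rw [actUpper_shear b (hU (hmem hy))]
    ext i
    fin_cases i <;> simp [b, hy]
  have h := OverlyDecorated.map_dir_of_injOn hinj (hmem hy)
  rw [hmap, hpt] at h
  rw [h]
  ext w
  simp [fderiv_actUpper_shear b (hU (hmem hy))]

/-- The field is constant, so it is determined by one horizontal direction, and every direction is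
iξ² for some ξ of modulus one. -/
theorem IsDecorated.exists_spinor_of_plane {S : OverlyDecorated R3} (hS : IsDecorated S)
    (hC : S.carrier = {y | y 2 = 1}) : ∃ κ, spinorHorosphere κ = S := by
  have hmem : (![0, 0, 1] : R3) ∈ S.carrier := by rw [hC]; rfl
  obtain ⟨w, ⟨γ, h0, hγ, hd⟩, hw0, hdir⟩ := hS.2.1.1 _ hmem
  have hw2 : w 2 = 0 := by
    refine (hasDerivAt_pi.1 hd 2).unique ((hasDerivAt_const (0 : ℝ) (1 : ℝ)).congr_of_eventuallyEq ?_)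
    filter_upwards [hγ] with s hs
    rwa [hC] at hs
  -- This is -i(w₀ + i w₁), so that a square root of z/|z| has the required direction iξ².
  set z : ℂ := ⟨w 1, -w 0⟩ with hz
  have hz0 : z ≠ 0 := by
    intro h
    have h1 := congrArg Complex.re h
    have h2 := congrArg Complex.im h
    simp [z] at h1 h2
    exact hw0 (by ext i; fin_cases i <;> simp [h1, h2, hw2])
  have hn : 0 < ‖z‖ := norm_pos_iff.2 hz0
  obtain ⟨x, hx⟩ := IsAlgClosed.exists_pow_nat_eq (z / ‖z‖) two_pos
  have hxn : ‖x‖ ^ 2 = 1 := by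
    rw [← norm_pow, hx, norm_div, Complex.norm_real, norm_norm, div_self hn.ne']
  have hx0 : x ≠ 0 := by
    rintro rfl
    simp at hxn
  have hcar : (spinorHorosphere ⟨![x, 0], fun h => hx0 (congrFun h 0)⟩).carrier = {y | y 2 = 1} :=
    spinorHorosphere_carrier_eq_plane.2 ⟨rfl, (Complex.normSq_eq_norm_sq x).trans hxn⟩
  have hre : (x ^ 2).re = w 1 / ‖z‖ := by rw [hx, Complex.div_ofReal_re]
  have him : (x ^ 2).im = -w 0 / ‖z‖ := by rw [hx, Complex.div_ofReal_im]
  have hvec : ![-(x ^ 2).im, (x ^ 2).re, 0] = ‖z‖⁻¹ • w := by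
    rw [hre, him]
    ext i
    fin_cases i <;> simp [hw2] <;> ring
  refine ⟨⟨![x, 0], fun h => hx0 (congrFun h 0)⟩, OverlyDecorated.ext (hcar.trans hC.symm) ?_⟩
  funext y
  by_cases hy : y 2 = 1
  · rw [hS.dir_eq_of_plane hC hy, hdir,
      spinorHorosphere_dir_of_eq_zero rfl (by rw [hcar]; exact hy) hy]
    change {v | ∃ c : ℝ, 0 < c ∧ v = c • ![-(x ^ 2).im, (x ^ 2).re, 0]} = _
    rw [hvec]
    ext v
    constructor
    · rintro ⟨c, hc, rfl⟩
      exact ⟨c * ‖z‖⁻¹, by positivity, by rw [smul_smul]⟩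
    · rintro ⟨c, hc, rfl⟩
      exact ⟨c * ‖z‖, by positivity, by rw [smul_smul, mul_inv_cancel_right₀ hn.ne']⟩
  · rw [spinorHorosphere_dir_of_notMem (by rwa [hcar]), hS.2.1.2 y (by rwa [hC])]

theorem IsDecorated.exists_spinor {S : OverlyDecorated R3} (hS : IsDecorated S) :
    ∃ κ, spinorHorosphere κ = S := by
  obtain ⟨κ, hκ⟩ := exists_spinorHorosphere_carrier_eq hS.1
  obtain ⟨A, rfl⟩ := exists_smul_baseSpinor κ
  obtain ⟨μ, hμ⟩ := (hS.map A⁻¹).exists_spinor_of_plane (by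
    have h := congrArg OverlyDecorated.carrier (spinorHorosphere_map_actUpper A⁻¹ (A • baseSpinor))
    rw [inv_smul_smul, spinorHorosphere_baseSpinor_carrier] at h
    rw [← h]
    change _ '' _ = _ '' _
    rw [hκ])
  refine ⟨A • μ, ?_⟩
  rw [← spinorHorosphere_map_actUpper, hμ, ← hS.map_mul, mul_inv_cancel, hS.map_one]

/-- By transitivity one spinor may be taken to be (1, 0). The common plane forces the other to be
(ξ, 0) with |ξ| = 1, and the common oriented direction forces ξ² = 1; without the orientation ξ² =
-1 would also survive. -/
theorem eq_or_eq_neg_one_smul_of_spinorHorosphere_eq {κ μ : Spinor}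
    (h : spinorHorosphere κ = spinorHorosphere μ) : μ = κ ∨ μ = (-1 : ℤˣ) • κ := by
  obtain ⟨A, rfl⟩ := exists_smul_baseSpinor κ
  obtain ⟨ν, rfl⟩ : ∃ ν, A • ν = μ := ⟨A⁻¹ • μ, smul_inv_smul A μ⟩
  replace h : spinorHorosphere baseSpinor = spinorHorosphere ν := by
    have := congrArg (fun S => S.map (actUpper A⁻¹)) h
    simpa only [spinorHorosphere_map_actUpper, inv_smul_smul] using this
  have hcar : (spinorHorosphere ν).carrier = {y | y 2 = 1} := by
    rw [← h, spinorHorosphere_baseSpinor_carrier]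
  obtain ⟨h1, h0⟩ := spinorHorosphere_carrier_eq_plane.1 hcar
  have hdir := congrArg (fun S : OverlyDecorated R3 => S.dir ![0, 0, 1]) h
  rw [spinorHorosphere_dir_of_eq_zero h1 (by rw [hcar]; rfl) rfl,
    spinorHorosphere_dir_of_eq_zero rfl (by rw [spinorHorosphere_baseSpinor_carrier]; rfl) rfl]
    at hdir
  obtain ⟨c, hc, hw⟩ := hdir.le ⟨1, one_pos, rfl⟩
  have e0 := congrFun hw 0
  have e1 := congrFun hw 1
  simp [baseSpinor, -Complex.inv_re, hc.ne', pow_two] at e0 e1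
  have hsq : (ν : Fin 2 → ℂ) 0 ^ 2 = 1 := by
    rw [Complex.normSq_apply] at h0
    set a := ((ν : Fin 2 → ℂ) 0).re
    set b := ((ν : Fin 2 → ℂ) 0).im
    have hb : b = 0 := by
      have hab : a * b = 0 := by linarith
      rcases mul_eq_zero.1 hab with ha | hb
      · rw [ha] at e1
        nlinarith [mul_nonneg hc.le (mul_self_nonneg b)]
      · exact hb
    apply Complex.ext
    · simp only [pow_two, Complex.mul_re, Complex.one_re]
      change a * a - b * b = 1
      rw [hb] at h0 ⊢
      linarith
    · simp only [pow_two, Complex.mul_im, Complex.one_im]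
      change a * b + b * a = 0
      rw [hb]
      ring
  rcases sq_eq_sq_iff_eq_or_eq_neg.1 (hsq.trans (one_pow 2).symm) with hν | hν
  · left
    refine congrArg (A • ·) (Subtype.ext ?_)
    ext i
    fin_cases i <;> simp [baseSpinor, hν, h1]
  · right
    rw [← smul_comm]
    refine congrArg (A • ·) (Subtype.ext ?_)
    rw [Spinor.coe_neg_one_smul]
    ext i
    fin_cases i <;> simp [baseSpinor, hν, h1]

/-! ## The coordinates of the decorated horosphere of a spinor -/

theorem tanh_half_log {T : ℝ} (hT : 0 < T) : Real.tanh (Real.log T / 2) = (T - 1) / (T + 1) := by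
  set E := Real.exp (Real.log T / 2) with hE
  have hE0 : 0 < E := Real.exp_pos _
  have hEE : E * E = T := by rw [hE, ← Real.exp_add, add_halves, Real.exp_log hT]
  rw [Real.tanh_eq_sinh_div_cosh, Real.sinh_eq, Real.cosh_eq, Real.exp_neg, ← hE, ← hEE]
  field_simp

theorem iInv_mem_hyperboloid {y : R3} (hy : y ∈ disc) : iInv y ∈ hyperboloid ∧ iMap (iInv y) = y := by
  have h : 0 < 1 - y ⬝ᵥ y := sub_pos.2 hy
  have hn : 0 ≤ y ⬝ᵥ y := by
    simp only [dotProduct, Fin.sum_univ_three]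
    exact add_nonneg (add_nonneg (mul_self_nonneg _) (mul_self_nonneg _)) (mul_self_nonneg _)
  have he : 1 + (1 + y ⬝ᵥ y) / (1 - y ⬝ᵥ y) = 2 / (1 - y ⬝ᵥ y) := by
    field_simp
    ring
  refine ⟨⟨?_, ?_⟩, ?_⟩
  · have hs : y ⬝ᵥ y = y 0 ^ 2 + y 1 ^ 2 + y 2 ^ 2 := by
      simp only [dotProduct, Fin.sum_univ_three]
      ring
    simp only [minkInner, iInv, Matrix.cons_val]
    field_simp
    linear_combination 4 * hs
  · change 0 < (1 + y ⬝ᵥ y) / (1 - y ⬝ᵥ y)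
    positivity
  · ext i
    fin_cases i <;> simp only [iMap, iInv, Matrix.cons_val] <;> simp [he] <;> field_simp

theorem iMap_image_hyperboloidHorosphere (κ : Spinor) :
    iMap '' (hyperboloidHorosphere κ).carrier =
      {y | y ∈ disc ∧ (y - Real.tanh ((ambientCoords κ).2 / 2) • (ambientCoords κ).1.1) ⬝ᵥ
        (y - (ambientCoords κ).1.1) = 0} := by
  have hT := nullVec_zero_pos (Spinor.ne_zero κ)
  have htanh : Real.tanh ((ambientCoords κ).2 / 2) = (nullVec κ 0 - 1) / (nullVec κ 0 + 1) :=
    tanh_half_log hT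
  have hp := minkInner_nullVec_self κ
  have key : ∀ x ∈ hyperboloid, minkInner x (nullVec κ) = 1 ↔
      (iMap x - Real.tanh ((ambientCoords κ).2 / 2) • (ambientCoords κ).1.1) ⬝ᵥ
        (iMap x - (ambientCoords κ).1.1) = 0 := by
    intro x hx
    have h1 : 0 < 1 + x 0 := by have := hx.2; positivity
    have hxx := hx.1
    -- The equation of the sphere with diameter from q to u is the horosphere equation ⟨x, p⟩ - 1
    -- times a positive factor; only nullity of p and ⟨x, x⟩ = 1 enter.
    have e : (iMap x - Real.tanh ((ambientCoords κ).2 / 2) • (ambientCoords κ).1.1) ⬝ᵥ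
        (iMap x - (ambientCoords κ).1.1) =
        2 / ((nullVec κ 0 + 1) * (1 + x 0)) * (minkInner x (nullVec κ) - 1) := by
      rw [htanh]
      simp only [ambientCoords]
      generalize nullVec κ = p at hT hp ⊢
      simp only [minkInner] at hp hxx ⊢
      simp [iMap, spatial, dotProduct, Fin.sum_univ_three]
      field_simp
      linear_combination (-p 0 ^ 2 * (p 0 + 1)) * hxx - ((p 0 - 1) * (1 + x 0) ^ 2) * hp
    rw [e, mul_eq_zero, sub_eq_zero]
    exact (or_iff_right (by positivity)).symm
  ext y
  constructor
  · rintro ⟨x, hx, rfl⟩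
    exact ⟨iMap_mem_disc hx.1, (key x hx.1).1 hx.2⟩
  · rintro ⟨hy, h⟩
    obtain ⟨h1, h2⟩ := iInv_mem_hyperboloid hy
    exact ⟨iInv y, ⟨h1, (key _ h1).2 (by rwa [h2])⟩, h2⟩

theorem fderiv_iMap {x w : Mink} (hx : x ∈ hyperboloid) (hw : w 0 = 0) :
    fderiv ℝ iMap x w = (1 + x 0)⁻¹ • spatial w := by
  refine fderiv_apply_eq_of_line (differentiableAt_iMap hx) (Filter.Eventually.of_forall ?_)
  intro s
  ext i
  fin_cases i <;> simp [iMap, spatial, hw] <;> ring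

theorem fderiv_jMap_mem_spinorHorosphere_dir (κ : Spinor) :
    fderiv ℝ jMap (Real.tanh ((ambientCoords κ).2 / 2) • (ambientCoords κ).1.1)
      (ambientCoords κ).1.2 ∈ (spinorHorosphere κ).dir
        (jMap (Real.tanh ((ambientCoords κ).2 / 2) • (ambientCoords κ).1.1)) := by
  have hT := nullVec_zero_pos (Spinor.ne_zero κ)
  have htanh : Real.tanh ((ambientCoords κ).2 / 2) = (nullVec κ 0 - 1) / (nullVec κ 0 + 1) :=
    tanh_half_log hT
  have hp := minkInner_nullVec_self κ
  have hw := minkInner_flagVec_nullVec κ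
  have hw0 : flagVec κ 0 = 0 := by simp [flagVec_eq]
  set T := nullVec κ 0 with hTdef
  -- The point (cosh t, sinh t · u) with t = log T, where the geodesic from (1, 0, 0, 0) towards u
  -- meets the horosphere. It is orthogonal to w, so there the flag vector is itself tangent.
  let x : Mink := ![(T ^ 2 + 1) / (2 * T), (T ^ 2 - 1) / (2 * T) * (nullVec κ 1 / T),
    (T ^ 2 - 1) / (2 * T) * (nullVec κ 2 / T), (T ^ 2 - 1) / (2 * T) * (nullVec κ 3 / T)]
  have hx0 : x 0 = (T ^ 2 + 1) / (2 * T) := rfl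
  have hx : x ∈ (hyperboloidHorosphere κ).carrier := by
    simp only [minkInner, ← hTdef] at hp
    refine ⟨⟨?_, by rw [hx0]; positivity⟩, ?_⟩
    · simp only [minkInner, x, Matrix.cons_val]
      field_simp
      linear_combination ((T ^ 2 - 1) ^ 2) * hp
    · change minkInner x (nullVec κ) = 1
      simp only [minkInner, x, Matrix.cons_val, ← hTdef]
      field_simp
      linear_combination (T ^ 2 - 1) * hp
  have hpt : iMap x = Real.tanh ((ambientCoords κ).2 / 2) • (ambientCoords κ).1.1 := by
    rw [htanh]
    simp only [ambientCoords, ← hTdef]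
    have h1 : 1 + (T ^ 2 + 1) / (2 * T) = (T + 1) ^ 2 / (2 * T) := by
      field_simp
      ring
    ext i
    fin_cases i <;> simp only [iMap, x, Matrix.cons_val, h1] <;> simp [spatial] <;> field_simp <;>
      ring
  have hline : lineVec κ x = flagVec κ := by
    have : minkInner x (flagVec κ) = 0 := by
      simp only [minkInner, hw0] at hw
      simp only [minkInner, x, Matrix.cons_val, hw0]
      linear_combination ((T ^ 2 - 1) / (2 * T) / T) * hw
    rw [lineVec, this, neg_zero, zero_smul, add_zero]
  have hpos : 0 < 1 + x 0 := by have := hx.1.2; positivity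
  rw [← hpt]
  -- On w the derivative of `iMap` is division by 1 + x₀; the factor cancels this and leaves the
  -- unit vector v = w/(2T).
  refine ⟨iMap x, ⟨x, hx, rfl⟩, rfl, _, ⟨x, hx, rfl, ((1 + x 0) / (2 * T)) • flagVec κ, ?_, ?_⟩, rfl⟩
  · change _ ∈ (hyperboloidHorosphere κ).dir x
    rw [hyperboloidHorosphere_dir hx, hline]
    exact ⟨_, by positivity, rfl⟩
  · rw [map_smul, fderiv_iMap hx.1 hw0, smul_smul]
    simp only [ambientCoords, ← hTdef]
    congr 1
    field_simp

/-! ## The bijection, the action and the theorem -/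

/-- The decorated horosphere of a spinor. -/
noncomputable def mapK (κ : Spinor) : DecoratedHorosphere :=
  ⟨spinorHorosphere κ, isDecorated_spinorHorosphere κ⟩

theorem hasCoordinates_mapK (κ : Spinor) : HasCoordinates (mapK κ) (coords κ) := by
  refine ⟨?_, fderiv_jMap_mem_spinorHorosphere_dir κ⟩
  exact congrArg (jMap '' ·) (iMap_image_hyperboloidHorosphere κ)

theorem mapK_eq_iff {κ μ : Spinor} : mapK κ = mapK μ ↔ μ = κ ∨ μ = (-1 : ℤˣ) • κ := by
  constructor
  · exact fun h => eq_or_eq_neg_one_smul_of_spinorHorosphere_eq (congrArg Subtype.val h)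
  · rintro (rfl | rfl)
    exacts [rfl, Subtype.ext (spinorHorosphere_neg κ).symm]

theorem mapK_surjective : Function.Surjective mapK := by
  rintro ⟨S, hS⟩
  obtain ⟨κ, rfl⟩ := IsDecorated.exists_spinor hS
  exact ⟨κ, rfl⟩

theorem ncard_preimage_mapK (D : DecoratedHorosphere) : (mapK ⁻¹' {D}).ncard = 2 := by
  obtain ⟨κ, rfl⟩ := mapK_surjective D
  have : mapK ⁻¹' {mapK κ} = {κ, (-1 : ℤˣ) • κ} := by
    ext μ
    exact eq_comm.trans mapK_eq_iff
  rw [this, Set.ncard_pair (Spinor.neg_one_smul_ne κ).symm]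

/-- The map from spinors up to sign to decorated horospheres. -/
noncomputable def mapKModSign : SpinorModSign → DecoratedHorosphere :=
  Quotient.lift mapK fun _ _ h => mapK_eq_iff.2 (modSign_eq_iff.1 (Quotient.sound h).symm)

theorem mapKModSign_bijective : Function.Bijective mapKModSign := by
  constructor
  · intro x y
    induction x using Quotient.inductionOn with
    | h κ =>
      induction y using Quotient.inductionOn with
      | h μ => exact fun h => (modSign_eq_iff.2 (mapK_eq_iff.1 h)).symm
  · intro D
    obtain ⟨κ, rfl⟩ := mapK_surjective D
    exact ⟨modSign κ, rfl⟩

/-- The action of `SL(2, ℂ)` on decorated horospheres. -/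
noncomputable instance : MulAction SL2C DecoratedHorosphere where
  smul A D := ⟨D.1.map (actUpper A), IsDecorated.map D.2 A⟩
  one_smul D := Subtype.ext (IsDecorated.map_one D.2)
  mul_smul A B D := Subtype.ext (IsDecorated.map_mul D.2 A B)

theorem mapK_smul (A : SL2C) (κ : Spinor) : mapK (A • κ) = A • mapK κ :=
  Subtype.ext (spinorHorosphere_map_actUpper A κ).symm

theorem mapKModSign_smul (A : SL2C) (x : SpinorModSign) :
    mapKModSign (A • x) = A • mapKModSign x := by
  induction x using Quotient.inductionOn with
  | h κ => exact mapK_smul A κ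

/-- The bijection between `UTS² × ℝ` and decorated horospheres. -/
noncomputable def coordsEquiv : UTS2 × ℝ ≃ DecoratedHorosphere :=
  (Equiv.ofBijective _ coordsModSign_bijective).symm.trans
    (Equiv.ofBijective _ mapKModSign_bijective)

theorem coordsEquiv_symm_mapKModSign (x : SpinorModSign) :
    coordsEquiv.symm (mapKModSign x) = coordsModSign x :=
  congrArg coordsModSign (Equiv.ofBijective_symm_apply_apply _ mapKModSign_bijective x)

/-- Central matrices are scalars r with r² = 1, and the quotient identifies κ with -κ. -/
theorem smul_eq_self_of_mem_center {A : SL2C} (hA : A ∈ Subgroup.center SL2C) (x : SpinorModSign) :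
    A • x = x := by
  induction x using Quotient.inductionOn with
  | h κ =>
    obtain ⟨r, hr, hrA⟩ := Matrix.SpecialLinearGroup.mem_center_iff.1 hA
    have hsmul : ((A • κ : Spinor) : Fin 2 → ℂ) = r • (κ : Fin 2 → ℂ) := by
      rw [Spinor.coe_smul, ← hrA]
      ext i
      simp [Matrix.mulVec_diagonal]
    refine modSign_eq_iff.2 ?_
    rcases sq_eq_sq_iff_eq_or_eq_neg.1 (hr.trans (one_pow 2).symm) with rfl | rfl
    · exact Or.inl (Subtype.ext (by rw [hsmul, one_smul]))
    · exact Or.inr (Subtype.ext (by rw [hsmul, Spinor.coe_neg_one_smul, neg_one_smul]))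

/-- An action of `SL(2, ℂ)` in which the centre acts trivially factors through `PSL(2, ℂ)`. -/
theorem exists_PSL2C_factor {X : Type*} [MulAction SL2C X]
    (h : ∀ A ∈ Subgroup.center SL2C, ∀ x : X, A • x = x) :
    ∃ ρ : PSL2C →* Equiv.Perm X, ∀ (A : SL2C) x, ρ (QuotientGroup.mk A) x = A • x :=
  ⟨QuotientGroup.lift _ (MulAction.toPermHom SL2C X) fun A hA => Equiv.ext (h A hA),
    fun _ _ => rfl⟩

end SpinorHoro

open scoped MatrixGroups Manifold ContDiff
open SpinorHoro
theorem mainTheorem8 :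
    ∃ (Θ : UTS2 × ℝ ≃ DecoratedHorosphere) (σ : SL2C →* Equiv.Perm DecoratedHorosphere)
      (K : Spinor → DecoratedHorosphere) (Kq : SpinorModSign → DecoratedHorosphere),
      (∀ x, HasCoordinates (Θ x) x) ∧
      (∀ A D, (σ A D).1 = D.1.map (actUpper A)) ∧
      (∀ κ, (K κ).1 = mapJ (mapI (mapH (mapG (mapF κ))))) ∧
      (∀ κ, Kq (modSign κ) = K κ) ∧
      SmoothToUTS2 (fun κ => Θ.symm (K κ)) ∧
      Function.Surjective K ∧
      (∀ D, (K ⁻¹' {D}).ncard = 2) ∧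
      (∀ A κ, K (A • κ) = σ A (K κ)) ∧
      SmoothToUTS2 (fun x => Θ.symm (Kq x)) ∧
      Function.Bijective Kq ∧
      (∀ (A : SL2C) x, Kq (A • x) = σ A (Kq x)) ∧
      (∃ ρ : PSL2C →* Equiv.Perm SpinorModSign, ∀ (A : SL2C) x, ρ (QuotientGroup.mk A) x = A • x) ∧
      ∃ ρ : PSL2C →* Equiv.Perm DecoratedHorosphere,
        ∀ A D, ρ (QuotientGroup.mk A) D = σ A D := by
  refine ⟨coordsEquiv, MulAction.toPermHom SL2C DecoratedHorosphere, mapK, mapKModSign, ?_,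
    fun _ _ => rfl, fun _ => rfl, fun _ => rfl, ?_, mapK_surjective, ncard_preimage_mapK,
    mapK_smul, ?_, mapKModSign_bijective, mapKModSign_smul,
    exists_PSL2C_factor fun _ hA x => smul_eq_self_of_mem_center hA x,
    exists_PSL2C_factor fun A hA D => ?_⟩
  · intro x
    obtain ⟨κ, rfl⟩ := coords_surjective x
    -- Every point of UTS² × ℝ is the coordinates of a spinor, so the prescribed correspondence
    -- needs checking only on horospheres of spinors.
    have h : coordsEquiv (coords κ) = mapK κ :=
      (Equiv.symm_apply_eq _).1 (coordsEquiv_symm_mapKModSign (modSign κ)) |>.symm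
    rw [h]
    exact hasCoordinates_mapK κ
  · have h : (fun κ => coordsEquiv.symm (mapK κ)) = coords :=
      funext fun κ => coordsEquiv_symm_mapKModSign (modSign κ)
    rw [h]
    exact smoothToUTS2_coords
  · simp only [coordsEquiv_symm_mapKModSign]
    exact smoothToUTS2_coordsModSign
  -- Triviality of the centre is carried over from spinors modulo sign by the equivariant
  -- surjection.
  · obtain ⟨x, rfl⟩ := mapKModSign_bijective.2 D
    rw [← mapKModSign_smul, smul_eq_self_of_mem_center hA]
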